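/- **Setting.** A subproduct system $X$ (over $\mathbb{N}\times\mathbb{N}$) is a family $\{X(s)\}_{s\in\mathbb{N}^2}$ of finite-dimensional complex Hilbert spaces with $X(0)=\mathbb{C}$, together with coisometries $U_{s,t}:X(s)\otimes X(t)\to X(s+t)$ such that $U_{s,0}$ and $U_{0,s}$ are the natural isomorphisms and $U_{s+t,r}(U_{s,t}\otimes I)=U_{s,t+r}(I\otimes U_{t,r})$ for all $s,t,r$. Let $\mathcal{F}_X=\bigoplus_{s}X(s)$ (Hilbert space direct sum), and for $\eta\in X(s)$ let $L^{(s)}_\eta\in B(\mathcal{F}_X)$ be given by $L^{(s)}_\eta\xi=U_{s,t}(\eta\otimes\xi)$ for $\xi\in X(t)$. The tensor algebra $\mathcal{A}_X\subset B(\mathcal{F}_X)$ is the norm-closed algebra generated by all $L^{(s)}_\eta$. Its vacuum character $\alpha_0^X$ is the character that vanishes on all $L^{(1,0)}_\eta$ and all $L^{(0,1)}_\eta$; explicitly $\alpha_0^X(T)=\langle T\Delta,\Delta\rangle$ with $\Delta=1\in X(0)$. Two subproduct systems $X,Y$ are isomorphic if there are unitaries $V_s:X(s)\to Y(\pi(s))$,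 $s\in\mathbb{N}^2$, with $V_{s+t}U^X_{s,t}=U^Y_{\pi(s),\pi(t)}(V_s\otimes V_t)$ for all $s,t$, where $\pi$ is either the identity or the coordinate switch of $\mathbb{N}^2$. Let $E=X(1,0)$ and $F=X(0,1)$ have orthonormal bases $e_1,\dots,e_m$ and $f_1,\dots,f_n$, and let $u:F\otimes E\to E\otimes F$ be a unitary with $U_{(1,0),(0,1)}u=U_{(0,1),(1,0)}$, with $u(f_j\otimes e_i)=\sum_{k,l}u_{(k,l),(i,j)}e_k\otimes f_l$. Let $J\subset\mathbb{C}[z_1,\dots,z_m,w_1,\dots,w_n]$ be the ideal generated by the polynomials $w_jz_i-\sum_{k,l}u_{(k,l),(i,j)}z_kw_l$ and by all polynomials $q^x=\sum a_{s_1,\dots,s_i}^{t_1,\dots,t_j}z_{s_1}\cdots z_{s_i}w_{t_1}\cdots w_{t_j}$, where $i,j\ge 0$ and $x=\sum a_{s_1,\dots,s_i}^{t_1,\dots,t_j}e_{s_1}\otimes\cdots\otimes e_{s_i}\otimes f_{t_1}\otimes\cdots\otimes f_{t_j}$ lies in the kernel of the iterated multiplication map $E^{\otimes i}\otimes F^{\otimes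 j}\to X(i,j)$. A polynomial is $(m,n)$-homogeneous of degree $(a,b)$ if each of its monomials has degree $a$ in $z_1,\dots,z_m$ and degree $b$ in $w_1,\dots,w_n$. $X$ is good if every nonzero $(m,n)$-homogeneous polynomial in $J$ has degree $(a,b)$ with $a,b>0$ (this does not depend on the choice of the bases and of $u$). **Theorem.** Let $X$ and $Y$ be subproduct systems over $\mathbb{N}\times\mathbb{N}$, and let $X$ be good. If $X(1,0)$ and $X(0,1)$ are both nonzero, assume that $Y(1,0)$ and $Y(0,1)$ are both nonzero as well. Let $\phi:\mathcal{A}_Y\to\mathcal{A}_X$ be an isometric isomorphism of algebras with $\alpha_0^X\circ\phi=\alpha_0^Y$. Then $X$ and $Y$ are isomorphic as subproduct systems, and there is a unitary $V:\mathcal{F}_X\to\mathcal{F}_Y$ such that $\phi(T)=V^*TV$ for all $T\in\mathcal{A}_Y$. -/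

import Mathlib

open scoped TensorProduct

universe u v

noncomputable section

/-- A subproduct system of finite-dimensional complex Hilbert spaces over `ℕ × ℕ`.

The one-dimensional space `H 0` is identified with `ℂ` through the unit vector `Δ`, and
`unit_mul`, `mul_unit` say that `U_{0,s}` and `U_{s,0}` are the natural isomorphisms.
The coisometry `U_{s,t} : H s ⊗ H t → H (s + t)` is written `U s t r h`, where `h : s + t = r`;
this only serves to avoid transports between `H ((s + t) + r)` and `H (s + (t + r))`. -/
structure SubproductSystem where
  H : ℕ × ℕ → Type u
  [normedAddCommGroup : ∀ s, NormedAddCommGroup (H s)]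
  [innerProductSpace : ∀ s, InnerProductSpace ℂ (H s)]
  [finiteDimensional : ∀ s, FiniteDimensional ℂ (H s)]
  U : ∀ s t r : ℕ × ℕ, s + t = r → (H s ⊗[ℂ] H t →ₗ[ℂ] H r)
  coisometry : ∀ (s t r : ℕ × ℕ) (h : s + t = r),
    U s t r h ∘ₗ LinearMap.adjoint (U s t r h) = LinearMap.id
  finrank_zero : Module.finrank ℂ (H 0) = 1
  Δ : H 0
  norm_Δ : ‖Δ‖ = 1
  unit_mul : ∀ (s : ℕ × ℕ) (x : H s), U 0 s s (zero_add s) (Δ ⊗ₜ x) = x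
  mul_unit : ∀ (s : ℕ × ℕ) (x : H s), U s 0 s (add_zero s) (x ⊗ₜ Δ) = x
  assoc : ∀ (s t r st tr str : ℕ × ℕ) (h₁ : s + t = st) (h₂ : st + r = str)
    (h₃ : t + r = tr) (h₄ : s + tr = str) (x : H s) (y : H t) (z : H r),
    U st r str h₂ (U s t st h₁ (x ⊗ₜ y) ⊗ₜ z) = U s tr str h₄ (x ⊗ₜ U t r tr h₃ (y ⊗ₜ z))

namespace SubproductSystem

attribute [instance] normedAddCommGroup innerProductSpace finiteDimensional

variable (X : SubproductSystem.{u})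

/-- Isomorphism of subproduct systems over `ℕ × ℕ`: a family of unitaries intertwining the
coisometries, along an automorphism `π` of `ℕ × ℕ` that is the identity or the coordinate switch.
(The relation at `s = t = 0` forces `V 0` to send `Δ` to `Δ`, so that `V 0` is the natural
identification.) -/
def Isomorphic (X : SubproductSystem.{u}) (Y : SubproductSystem.{v}) : Prop :=
  ∃ π : ℕ × ℕ ≃+ ℕ × ℕ, (π = AddEquiv.refl (ℕ × ℕ) ∨ π = AddEquiv.prodComm) ∧
    ∃ V : ∀ s : ℕ × ℕ, X.H s ≃ₗᵢ[ℂ] Y.H (π s),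
      ∀ (s t r : ℕ × ℕ) (h : s + t = r) (x : X.H s) (y : X.H t),
        V r (X.U s t r h (x ⊗ₜ y)) =
          Y.U (π s) (π t) (π r) (by rw [← map_add, h]) (V s x ⊗ₜ V t y)

/-- The Fock space of `X`: the Hilbert space direct sum of all `X.H s`. -/
abbrev Fock : Type u := lp X.H 2

theorem norm_U_le (s t r : ℕ × ℕ) (h : s + t = r) (z : X.H s ⊗[ℂ] X.H t) :
    ‖X.U s t r h z‖ ≤ ‖z‖ := by
  set T := X.U s t r h with hT
  have hc : ∀ w, T (LinearMap.adjoint T w) = w := fun w =>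
    LinearMap.congr_fun (X.coisometry s t r h) w
  have hiso : ∀ w, ‖LinearMap.adjoint T w‖ * ‖LinearMap.adjoint T w‖ = ‖w‖ * ‖w‖ := by
    intro w
    have h1 := LinearMap.adjoint_inner_right T (LinearMap.adjoint T w) w
    rw [hc w, inner_self_eq_norm_sq_to_K, inner_self_eq_norm_sq_to_K, sq, sq] at h1
    exact_mod_cast h1
  have hiso' : ∀ w, ‖LinearMap.adjoint T w‖ = ‖w‖ := fun w =>
    (mul_self_inj (norm_nonneg _) (norm_nonneg _)).1 (hiso w)
  have h2 : ‖T z‖ * ‖T z‖ ≤ ‖z‖ * ‖T z‖ := by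
    have h3 := norm_inner_le_norm (𝕜 := ℂ) z (LinearMap.adjoint T (T z))
    rw [LinearMap.adjoint_inner_right, inner_self_eq_norm_sq_to_K, hiso'] at h3
    simpa [sq] using h3
  rcases (norm_nonneg (T z)).eq_or_lt with h0 | h0
  · rw [← h0]; exact norm_nonneg z
  · exact le_of_mul_le_mul_right h2 h0

/-- The `r`-th coordinate of `L_η^{(s)} f`: it is `U_{s,t} (η ⊗ f t)` if `r = s + t`, and `0` if
`r` is not of this form. -/
def creationFun {s : ℕ × ℕ} (η : X.H s) (f : ∀ t, X.H t) (r : ℕ × ℕ) : X.H r :=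
  if h : s ≤ r then X.U s (r - s) r (add_tsub_cancel_of_le h) (η ⊗ₜ f (r - s)) else 0

theorem sum_creationFun_le {s : ℕ × ℕ} (η : X.H s) (f : X.Fock) (S : Finset (ℕ × ℕ)) :
    ∑ r ∈ S, ‖X.creationFun η f r‖ ^ (2 : ENNReal).toReal ≤
      (‖η‖ * ‖f‖) ^ (2 : ENNReal).toReal := by
  have h2 : (0 : ℝ) < (2 : ENNReal).toReal := by norm_num
  rw [Real.mul_rpow (norm_nonneg _) (norm_nonneg _)]
  have hinj : Set.InjOn (fun r : ℕ × ℕ => r - s) (S.filter (fun r => s ≤ r)) := by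
    intro a ha b hb hab
    have ha' : s ≤ a := (Finset.mem_filter.1 ha).2
    have hb' : s ≤ b := (Finset.mem_filter.1 hb).2
    have hab' : a - s = b - s := hab
    rw [← add_tsub_cancel_of_le ha', ← add_tsub_cancel_of_le hb', hab']
  calc ∑ r ∈ S, ‖X.creationFun η f r‖ ^ (2 : ENNReal).toReal
      = ∑ r ∈ S.filter (fun r => s ≤ r), ‖X.creationFun η f r‖ ^ (2 : ENNReal).toReal := by
        rw [Finset.sum_filter]
        refine Finset.sum_congr rfl fun r _ => ?_
        split_ifs with h
        · rfl
        · simp [creationFun, h]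
    _ ≤ ∑ r ∈ S.filter (fun r => s ≤ r),
          ‖η‖ ^ (2 : ENNReal).toReal * ‖f (r - s)‖ ^ (2 : ENNReal).toReal := by
        refine Finset.sum_le_sum fun r hr => ?_
        have h : s ≤ r := (Finset.mem_filter.1 hr).2
        rw [← Real.mul_rpow (norm_nonneg _) (norm_nonneg _)]
        refine Real.rpow_le_rpow (norm_nonneg _) ?_ h2.le
        rw [creationFun, dif_pos h, ← TensorProduct.norm_tmul (𝕜 := ℂ)]
        exact X.norm_U_le _ _ _ _ _
    _ = ‖η‖ ^ (2 : ENNReal).toReal *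
          ∑ t ∈ (S.filter (fun r => s ≤ r)).image (fun r => r - s),
            ‖f t‖ ^ (2 : ENNReal).toReal := by
        rw [Finset.sum_image hinj, Finset.mul_sum]
    _ ≤ ‖η‖ ^ (2 : ENNReal).toReal * ‖f‖ ^ (2 : ENNReal).toReal :=
        mul_le_mul_of_nonneg_left (lp.sum_rpow_le_norm_rpow h2 f _)
          (Real.rpow_nonneg (norm_nonneg _) _)

/-- The operator `L_η^{(s)}` on the Fock space. -/
def creation {s : ℕ × ℕ} (η : X.H s) : X.Fock →L[ℂ] X.Fock :=
  LinearMap.mkContinuous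
    { toFun := fun f => ⟨X.creationFun η f, memℓp_gen' (X.sum_creationFun_le η f)⟩
      map_add' := by
        intro f g
        ext r
        simp only [lp.coeFn_add, Pi.add_apply, creationFun]
        split_ifs with h
        · simp [TensorProduct.tmul_add]
        · simp
      map_smul' := by
        intro c f
        ext r
        simp only [lp.coeFn_smul, Pi.smul_apply, creationFun, RingHom.id_apply]
        split_ifs with h
        · simp [TensorProduct.tmul_smul]
        · simp }
    ‖η‖
    (fun f => lp.norm_le_of_forall_sum_le (by norm_num)
      (mul_nonneg (norm_nonneg _) (norm_nonneg _)) (X.sum_creationFun_le η f))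

theorem creation_apply {s : ℕ × ℕ} (η : X.H s) (f : X.Fock) (r : ℕ × ℕ) :
    X.creation η f r = X.creationFun η f r := rfl

/-- On the summand `X.H t`, the operator `L_η^{(s)}` is `ξ ↦ U_{s,t} (η ⊗ ξ)`. -/
theorem creation_single {s : ℕ × ℕ} (η : X.H s) (t r : ℕ × ℕ) (h : s + t = r) (ξ : X.H t) :
    X.creation η (lp.single 2 t ξ) = lp.single 2 r (X.U s t r h (η ⊗ₜ ξ)) := by
  subst h
  ext q
  rw [creation_apply, creationFun]
  by_cases hq : q = s + t
  · subst hq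
    have hgen : ∀ (w : ℕ × ℕ) (hw : s + w = s + t),
        X.U s w (s + t) hw (η ⊗ₜ (lp.single 2 t ξ : X.Fock) w) =
          X.U s t (s + t) rfl (η ⊗ₜ ξ) := by
      intro w hw
      obtain rfl : w = t := add_left_cancel hw
      rw [lp.single_apply_self]
    rw [dif_pos le_self_add, lp.single_apply_self]
    exact hgen _ _
  · rw [lp.single_apply_ne _ _ _ hq]
    split_ifs with h
    · have hne : q - s ≠ t := fun e => hq (by rw [← e, add_tsub_cancel_of_le h])
      rw [lp.single_apply_ne _ _ _ hne]
      simp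
    · rfl

/-- The tensor algebra of `X`: the norm closed algebra of operators on the Fock space generated by
all `L_η^{(s)}`. (The identity is the generator `L_Δ^{(0)}`.) -/
def tensorAlgebra : Subalgebra ℂ (X.Fock →L[ℂ] X.Fock) :=
  (Algebra.adjoin ℂ {T | ∃ (s : ℕ × ℕ) (η : X.H s), T = X.creation η}).topologicalClosure

theorem creation_mem {s : ℕ × ℕ} (η : X.H s) : X.creation η ∈ X.tensorAlgebra :=
  Subalgebra.le_topologicalClosure _ (Algebra.subset_adjoin ⟨s, η, rfl⟩)

/-- `L_η^{(s)}` as an element of the tensor algebra. -/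
def shift {s : ℕ × ℕ} (η : X.H s) : X.tensorAlgebra := ⟨X.creation η, X.creation_mem η⟩

/-- The vacuum vector of the Fock space. -/
def vacuum : X.Fock := lp.single 2 0 X.Δ

theorem inner_vacuum (f : X.Fock) : inner ℂ X.vacuum f = inner ℂ X.Δ (f 0) := by
  rw [vacuum, lp.inner_single_left]

theorem vacuum_apply_zero : X.vacuum 0 = X.Δ := lp.single_apply_self _ _ _

theorem norm_vacuum : ‖X.vacuum‖ = 1 := by
  rw [vacuum, lp.norm_single (by norm_num), X.norm_Δ]

theorem inner_vacuum_self : inner ℂ X.vacuum X.vacuum = 1 := by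
  rw [inner_vacuum, vacuum_apply_zero, inner_self_eq_norm_sq_to_K, X.norm_Δ]
  simp

theorem exists_eq_smul_Δ (η : X.H 0) : ∃ c : ℂ, η = c • X.Δ := by
  have h0 : X.Δ ≠ 0 := by
    intro h
    have := X.norm_Δ
    rw [h, norm_zero] at this
    exact zero_ne_one this
  obtain ⟨c, hc⟩ := (finrank_eq_one_iff_of_nonzero' X.Δ h0).1 X.finrank_zero η
  exact ⟨c, hc.symm⟩

theorem creation_smul_Δ (c : ℂ) (f : X.Fock) : X.creation (c • X.Δ) f = c • f := by
  ext r
  rw [creation_apply, creationFun, dif_pos (zero_le)]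
  have hgen : ∀ (w : ℕ × ℕ) (hw : 0 + w = r), X.U 0 w r hw ((c • X.Δ) ⊗ₜ f w) = c • f r := by
    intro w hw
    obtain rfl : w = r := by rw [← hw, zero_add]
    rw [← TensorProduct.smul_tmul', map_smul, X.unit_mul]
  exact hgen _ _

theorem inner_vacuum_creation {s : ℕ × ℕ} (η : X.H s) (f : X.Fock) :
    inner ℂ X.vacuum (X.creation η f) =
      inner ℂ X.vacuum (X.creation η X.vacuum) * inner ℂ X.vacuum f := by
  by_cases hs : s = 0
  · subst hs
    obtain ⟨c, rfl⟩ := X.exists_eq_smul_Δ η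
    rw [creation_smul_Δ, creation_smul_Δ, inner_smul_right, inner_smul_right, inner_vacuum_self,
      mul_one]
  · have h : ¬ s ≤ 0 := fun h => hs (le_antisymm h (zero_le))
    rw [inner_vacuum, inner_vacuum, creation_apply, creation_apply, creationFun, creationFun,
      dif_neg h, dif_neg h, inner_zero_right, zero_mul]

theorem inner_vacuum_apply {T : X.Fock →L[ℂ] X.Fock} (hT : T ∈ X.tensorAlgebra) (f : X.Fock) :
    inner ℂ X.vacuum (T f) = inner ℂ X.vacuum (T X.vacuum) * inner ℂ X.vacuum f := by
  have hclosed : IsClosed {T : X.Fock →L[ℂ] X.Fock |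
      inner ℂ X.vacuum (T f) = inner ℂ X.vacuum (T X.vacuum) * inner ℂ X.vacuum f} :=
    isClosed_eq (by fun_prop) (by fun_prop)
  refine closure_minimal (fun T hT => ?_) hclosed hT
  have key : ∀ g, inner ℂ X.vacuum (T g) =
      inner ℂ X.vacuum (T X.vacuum) * inner ℂ X.vacuum g := by
    refine Algebra.adjoin_induction (p := fun T _ => ∀ g, inner ℂ X.vacuum (T g) =
      inner ℂ X.vacuum (T X.vacuum) * inner ℂ X.vacuum g) ?_ ?_ ?_ ?_ hT
    · rintro _ ⟨s, η, rfl⟩ g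
      exact X.inner_vacuum_creation η g
    · intro c g
      have hn := X.norm_vacuum
      simp [Algebra.algebraMap_eq_smul_one, hn]
    · intro S T _ _ hS hT g
      simp only [add_apply, inner_add_right, hS g, hT g, add_mul]
    · intro S T _ _ hS hT g
      simp only [mul_apply_eq_comp, hS (T g), hT g, hS (T X.vacuum), mul_assoc]
  exact key f

/-- The vacuum character `α₀` of the tensor algebra, `T ↦ ⟨Δ, T Δ⟩`. It is the unique character
that vanishes on all `L_η^{(1,0)}` and all `L_η^{(0,1)}` (`vacuumCharacter_shift` and
`eq_vacuumCharacter` below), that is, the character whose point in `ℂ^m × ℂ^n` is zero. -/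
def vacuumCharacter : X.tensorAlgebra →ₐ[ℂ] ℂ :=
  AlgHom.ofLinearMap
    { toFun := fun T => inner ℂ X.vacuum ((T : X.Fock →L[ℂ] X.Fock) X.vacuum)
      map_add' := by intro S T; simp
      map_smul' := by intro c T; simp }
    X.inner_vacuum_self
    (by
      intro S T
      exact X.inner_vacuum_apply S.2 ((T : X.Fock →L[ℂ] X.Fock) X.vacuum))

theorem vacuumCharacter_shift {s : ℕ × ℕ} (hs : s ≠ 0) (η : X.H s) :
    X.vacuumCharacter (X.shift η) = 0 := by
  have h : ¬ s ≤ 0 := fun h => hs (le_antisymm h (zero_le))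
  change inner ℂ X.vacuum (X.creation η X.vacuum) = 0
  rw [inner_vacuum, creation_apply, creationFun, dif_neg h, inner_zero_right]

theorem creation_U_tmul {s t r : ℕ × ℕ} (h : s + t = r) (x : X.H s) (y : X.H t) :
    X.creation (X.U s t r h (x ⊗ₜ y)) = X.creation x * X.creation y := by
  subst h
  ext f q
  change X.creationFun _ f q = X.creationFun x (X.creation y f) q
  by_cases h1 : s + t ≤ q
  · have h2 : s ≤ q := le_self_add.trans h1
    have h3 : t ≤ q - s := le_tsub_of_add_le_left h1
    have hgen : ∀ (w : ℕ × ℕ) (hw : s + t + w = q) (w' : ℕ × ℕ) (hw' : t + w' = q - s),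
        X.U (s + t) w q hw (X.U s t (s + t) rfl (x ⊗ₜ y) ⊗ₜ f w) =
          X.U s (q - s) q (add_tsub_cancel_of_le h2)
            (x ⊗ₜ X.U t w' (q - s) hw' (y ⊗ₜ f w')) := by
      intro w hw w' hw'
      obtain rfl : w = w' := by
        apply add_left_cancel (a := s + t)
        rw [hw, add_assoc, hw', add_tsub_cancel_of_le h2]
      exact X.assoc _ _ _ _ _ _ _ _ _ _ _ _ _
    rw [creationFun, dif_pos h1, creationFun, dif_pos h2, creation_apply, creationFun,
      dif_pos h3]
    exact hgen _ _ _ _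
  · rw [creationFun, dif_neg h1, creationFun]
    split_ifs with h2
    · have h3 : ¬ t ≤ q - s := fun h3 => h1 (by
        rw [← add_tsub_cancel_of_le h2]; exact add_le_add_right h3 s)
      rw [creation_apply, creationFun, dif_neg h3, TensorProduct.tmul_zero, map_zero]
    · rfl

theorem shift_add {s : ℕ × ℕ} (x y : X.H s) : X.shift (x + y) = X.shift x + X.shift y := by
  apply Subtype.ext
  ext f q
  change X.creationFun (x + y) f q = X.creationFun x f q + X.creationFun y f q
  simp only [creationFun]
  split_ifs
  · simp [TensorProduct.add_tmul]
  · simp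

theorem eq_vacuumCharacter (α : X.tensorAlgebra →ₐ[ℂ] ℂ)
    (h₁ : ∀ η : X.H (1, 0), α (X.shift η) = 0) (h₂ : ∀ η : X.H (0, 1), α (X.shift η) = 0) :
    α = X.vacuumCharacter := by
  have hcl : IsClosed (X.tensorAlgebra : Set (X.Fock →L[ℂ] X.Fock)) :=
    Subalgebra.isClosed_topologicalClosure _
  have : CompleteSpace X.tensorAlgebra := hcl.completeSpace_coe
  have hfac : ∀ (s t r : ℕ × ℕ) (h : s + t = r), (∀ x : X.H s, α (X.shift x) = 0) →
      ∀ η : X.H r, α (X.shift η) = 0 := by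
    intro s t r h h0 η
    have hη : X.U s t r h (LinearMap.adjoint (X.U s t r h) η) = η :=
      LinearMap.congr_fun (X.coisometry s t r h) η
    rw [← hη]
    induction LinearMap.adjoint (X.U s t r h) η using TensorProduct.induction_on with
    | zero =>
      have : X.shift (0 : X.H r) = 0 := by simpa using X.shift_add (0 : X.H r) 0
      rw [map_zero, this, map_zero]
    | tmul x y =>
      have : X.shift (X.U s t r h (x ⊗ₜ y)) = X.shift x * X.shift y :=
        Subtype.ext (X.creation_U_tmul h x y)
      rw [this, map_mul, h0, zero_mul]
    | add a b ha hb => rw [map_add, shift_add, map_add, ha, hb, add_zero]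
  have hgen : ∀ (s : ℕ × ℕ) (η : X.H s), α (X.shift η) = X.vacuumCharacter (X.shift η) := by
    intro s η
    by_cases hs : s = 0
    · subst hs
      obtain ⟨c, rfl⟩ := X.exists_eq_smul_Δ η
      have : X.shift (c • X.Δ) = algebraMap ℂ X.tensorAlgebra c := by
        apply Subtype.ext
        ext1 f
        exact (X.creation_smul_Δ c f).trans (by
          simp [Algebra.algebraMap_eq_smul_one])
      rw [this, AlgHom.commutes, AlgHom.commutes]
    · rw [X.vacuumCharacter_shift hs]
      obtain ⟨a, b⟩ := s
      by_cases ha : a = 0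
      · have hb : b ≠ 0 := fun hb => hs (by rw [ha, hb]; rfl)
        exact hfac (0, 1) (a, b - 1) (a, b) (by ext <;> simp; omega) h₂ η
      · exact hfac (1, 0) (a - 1, b) (a, b) (by ext <;> simp; omega) h₁ η
  have hα : Continuous α := (AlgHom.toContinuousLinearMap α).continuous
  have hβ : Continuous X.vacuumCharacter :=
    (AlgHom.toContinuousLinearMap X.vacuumCharacter).continuous
  have hE : IsClosed {T : X.tensorAlgebra | α T = X.vacuumCharacter T} := isClosed_eq hα hβ
  have hadj : ∀ (T : X.Fock →L[ℂ] X.Fock)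
      (_ : T ∈ Algebra.adjoin ℂ {T | ∃ (s : ℕ × ℕ) (η : X.H s), T = X.creation η}),
      ∃ hT : T ∈ X.tensorAlgebra, α ⟨T, hT⟩ = X.vacuumCharacter ⟨T, hT⟩ := by
    intro T hT
    induction hT using Algebra.adjoin_induction with
    | mem T h =>
      obtain ⟨s, η, rfl⟩ := h
      exact ⟨X.creation_mem η, hgen s η⟩
    | algebraMap c =>
      exact ⟨Subalgebra.algebraMap_mem _ c,
        (α.commutes c).trans (X.vacuumCharacter.commutes c).symm⟩
    | add S T _ _ hS hT =>
      obtain ⟨hS, eS⟩ := hS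
      obtain ⟨hT, eT⟩ := hT
      refine ⟨add_mem hS hT, ?_⟩
      exact (map_add α ⟨S, hS⟩ ⟨T, hT⟩).trans ((congrArg₂ (· + ·) eS eT).trans
        (map_add X.vacuumCharacter ⟨S, hS⟩ ⟨T, hT⟩).symm)
    | mul S T _ _ hS hT =>
      obtain ⟨hS, eS⟩ := hS
      obtain ⟨hT, eT⟩ := hT
      refine ⟨mul_mem hS hT, ?_⟩
      exact (map_mul α ⟨S, hS⟩ ⟨T, hT⟩).trans ((congrArg₂ (· * ·) eS eT).trans
        (map_mul X.vacuumCharacter ⟨S, hS⟩ ⟨T, hT⟩).symm)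
  ext T
  have hT : T ∈ closure {T : X.tensorAlgebra |
      (T : X.Fock →L[ℂ] X.Fock) ∈
        Algebra.adjoin ℂ {T | ∃ (s : ℕ × ℕ) (η : X.H s), T = X.creation η}} := by
    rw [closure_subtype]
    refine closure_mono ?_ T.2
    intro S hS
    exact ⟨⟨S, (hadj S hS).1⟩, hS, rfl⟩
  refine closure_minimal ?_ hE hT
  intro S hS
  exact (hadj S.1 hS).2

/-- A commutation relation for `X`: a unitary `u : F ⊗ E → E ⊗ F`, where `E = X(1,0)` and
`F = X(0,1)`, with `U_{(1,0),(0,1)} ∘ u = U_{(0,1),(1,0)}`. (As `U_{(1,0),(0,1)}` is a coisometry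
with initial projection `p = U_{(1,0),(0,1)}^* U_{(1,0),(0,1)}`, this is the same as
`p u = U_{(1,0),(0,1)}^* U_{(0,1),(1,0)}`.) -/
def IsCommutationRelation
    (u : X.H (0, 1) ⊗[ℂ] X.H (1, 0) ≃ₗᵢ[ℂ] X.H (1, 0) ⊗[ℂ] X.H (0, 1)) : Prop :=
  ∀ z, X.U (1, 0) (0, 1) (1, 1) rfl (u z) = X.U (0, 1) (1, 0) (1, 1) rfl z

section Polynomials

variable {m n : ℕ} (e : OrthonormalBasis (Fin m) ℂ (X.H (1, 0)))
  (f : OrthonormalBasis (Fin n) ℂ (X.H (0, 1)))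

/-- The polynomial `p_{i,j} = w_j z_i - ∑_{k,l} u_{(k,l),(i,j)} z_k w_l`, where
`u (f_j ⊗ e_i) = ∑_{k,l} u_{(k,l),(i,j)} e_k ⊗ f_l`. The variables `z_k`, `w_l` are indexed by
`Sum.inl k`, `Sum.inr l`. -/
def commPoly (u : X.H (0, 1) ⊗[ℂ] X.H (1, 0) ≃ₗᵢ[ℂ] X.H (1, 0) ⊗[ℂ] X.H (0, 1))
    (i : Fin m) (j : Fin n) : MvPolynomial (Fin m ⊕ Fin n) ℂ :=
  MvPolynomial.X (Sum.inr j) * MvPolynomial.X (Sum.inl i) -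
    ∑ k : Fin m, ∑ l : Fin n,
      MvPolynomial.C (inner ℂ (e k ⊗ₜ[ℂ] f l) (u (f j ⊗ₜ[ℂ] e i))) *
        MvPolynomial.X (Sum.inl k) * MvPolynomial.X (Sum.inr l)

/-- The value, in the summand `X(i,j)` of the Fock space, of the iterated multiplication map
`E^{⊗i} ⊗ F^{⊗j} → X(i,j)` of `X` on the vector
`x = ∑ a(s,t) e_{s₁} ⊗ ⋯ ⊗ e_{sᵢ} ⊗ f_{t₁} ⊗ ⋯ ⊗ f_{tⱼ}`, given by its coordinates `a`.
This map is a coisometry. Its initial space is the copy of `X(i,j)` inside `E^{⊗i} ⊗ F^{⊗j}` in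
the standard subproduct system isomorphic to `X`, so the value vanishes exactly when
`x ∈ E^{⊗i} ⊗ F^{⊗j} ⊖ X(i,j)`. -/
def tensorValue {i j : ℕ} (a : (Fin i → Fin m) → (Fin j → Fin n) → ℂ) : X.Fock :=
  ∑ s : Fin i → Fin m, ∑ t : Fin j → Fin n,
    a s t • ((List.ofFn fun k => X.creation (e (s k))).prod *
      (List.ofFn fun l => X.creation (f (t l))).prod) X.vacuum

end Polynomials

/-- The polynomial `q^x` of a vector `x ∈ E^{⊗i} ⊗ F^{⊗j}` with coordinates `a`. -/
def tensorPoly {m n i j : ℕ} (a : (Fin i → Fin m) → (Fin j → Fin n) → ℂ) :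
    MvPolynomial (Fin m ⊕ Fin n) ℂ :=
  ∑ s : Fin i → Fin m, ∑ t : Fin j → Fin n,
    MvPolynomial.C (a s t) * (∏ k, MvPolynomial.X (Sum.inl (s k))) *
      ∏ l, MvPolynomial.X (Sum.inr (t l))

/-- The ideal `J` of `X`, relative to orthonormal bases of `X(1,0)` and `X(0,1)` and a commutation
relation `u`: it is generated by all `p_{i,j}` and all `q^x` with
`x ∈ E^{⊗i} ⊗ F^{⊗j} ⊖ X(i,j)`. -/
def charIdeal {m n : ℕ} (e : OrthonormalBasis (Fin m) ℂ (X.H (1, 0)))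
    (f : OrthonormalBasis (Fin n) ℂ (X.H (0, 1)))
    (u : X.H (0, 1) ⊗[ℂ] X.H (1, 0) ≃ₗᵢ[ℂ] X.H (1, 0) ⊗[ℂ] X.H (0, 1)) :
    Ideal (MvPolynomial (Fin m ⊕ Fin n) ℂ) :=
  Ideal.span ({p | ∃ (i : Fin m) (j : Fin n), p = X.commPoly e f u i j} ∪
    {p | ∃ (i j : ℕ) (a : (Fin i → Fin m) → (Fin j → Fin n) → ℂ),
      X.tensorValue e f a = 0 ∧ p = tensorPoly a})

/-- `p` is `(m,n)`-homogeneous of degree `(a,b)`: every monomial of `p` has degree `a` in the `z`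
variables and degree `b` in the `w` variables. -/
def IsBihomogeneous {m n : ℕ} (p : MvPolynomial (Fin m ⊕ Fin n) ℂ) (a b : ℕ) : Prop :=
  p.IsWeightedHomogeneous (Sum.elim (fun _ => ((1, 0) : ℕ × ℕ)) fun _ => (0, 1)) (a, b)

/-- `X` is good: the degrees of all nonzero `(m,n)`-homogeneous polynomials in the ideal `J` of `X`
have positive coordinates. (The set of these degrees does not depend on the orthonormal bases and
the commutation relation.) -/
def Good : Prop :=
  ∃ (m n : ℕ) (e : OrthonormalBasis (Fin m) ℂ (X.H (1, 0)))
    (f : OrthonormalBasis (Fin n) ℂ (X.H (0, 1)))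
    (u : X.H (0, 1) ⊗[ℂ] X.H (1, 0) ≃ₗᵢ[ℂ] X.H (1, 0) ⊗[ℂ] X.H (0, 1)),
    X.IsCommutationRelation u ∧
      ∀ p ∈ X.charIdeal e f u, p ≠ 0 →
        ∀ a b : ℕ, IsBihomogeneous p a b → 0 < a ∧ 0 < b

end SubproductSystem

end

/-! An element T of a tensor algebra behaves like a formal power series: it acts through the formal
product with its symbol TΔ (`apply_eq_sum`). A homomorphism that preserves the vacuum characters
preserves the series without constant term, hence does not lower total degree
(`hasOrder_map_shift`), and the linear parts of φ and of its inverse are mutually inverse. Two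
things remain: up to the switch, the linear part respects the splitting of degree one into X(1,0)
and X(0,1), and φ has no other terms on the generators.

For the splitting, φ is tested on multiplicative families of functionals on the fibres
(`GradedCharacter`), a substitute for points of the character space that need no boundedness.
Leading terms of a pullback form such a family again (`GradedCharacter.comap`), so the transposed
linear part carries the cone of degree one data of X into that of Y. A Schwarz lemma
(`GradedCharacter.norm_coef_one_le`), obtained from the degree n coefficient of Tⁿ, makes this map
contractive for the maximum of the two dual norms. Applied to both φ and its inverse, it gives
preservation of norms on the cones. If X is good, its cone contains both coordinate subspaces.
Strict convexity of the Hilbert norms then forces each of their vectors into a single coordinate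
subspace on the other side (`fst_eq_zero_or_snd_eq_zero_of_norm_preserving`), and linearity makes
the choice uniform.

Once degree one is split, the norm of η is at most that of its linear image, because the inverse is
contractive too; this leaves no room for other coordinates of φ(L_η)Δ (`VacuumIso.hom_shift_eq`).
Multiplicativity spreads this to all degrees and yields fibre unitaries, whose direct sum implements
φ. -/

noncomputable section

namespace SubproductSystem

/-! ### Symbols and the filtration by total degree. -/

section Structure

variable (X : SubproductSystem.{u})

/-- `η ↦ L_η^{(s)}` as a linear map into the tensor algebra. -/
def shiftₗ (s : ℕ × ℕ) : X.H s →ₗ[ℂ] X.tensorAlgebra where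
  toFun η := X.shift η
  map_add' := X.shift_add
  map_smul' c η := by
    apply Subtype.ext
    ext f q
    change X.creationFun (c • η) f q = c • X.creationFun η f q
    simp only [creationFun]
    split_ifs
    · rw [← TensorProduct.smul_tmul', map_smul]
    · simp

@[simp] theorem shiftₗ_apply {s : ℕ × ℕ} (η : X.H s) : X.shiftₗ s η = X.shift η := rfl

/-- Evaluation of an element of the tensor algebra at the vacuum vector. -/
def symbol : X.tensorAlgebra →L[ℂ] X.Fock :=
  (ContinuousLinearMap.apply ℂ X.Fock X.vacuum).comp
    (X.tensorAlgebra.toSubmodule.subtypeL)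

theorem symbol_mul (S T : X.tensorAlgebra) :
    X.symbol (S * T) = (S : X.Fock →L[ℂ] X.Fock) (X.symbol T) := rfl

theorem norm_symbol_le (T : X.tensorAlgebra) : ‖X.symbol T‖ ≤ ‖T‖ := by
  have := (T : X.Fock →L[ℂ] X.Fock).le_opNorm X.vacuum
  rwa [norm_vacuum, mul_one] at this

theorem symbol_shift {s : ℕ × ℕ} (η : X.H s) : X.symbol (X.shift η) = lp.single 2 s η :=
  (X.creation_single η 0 s (add_zero s) X.Δ).trans (by rw [X.mul_unit])

theorem symbol_shift_self {s : ℕ × ℕ} (η : X.H s) : X.symbol (X.shift η) s = η := by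
  rw [symbol_shift, lp.single_apply_self]

theorem symbol_shift_ne {s t : ℕ × ℕ} (η : X.H s) (h : t ≠ s) :
    X.symbol (X.shift η) t = 0 := by
  rw [symbol_shift, lp.single_apply_ne _ _ _ h]

theorem norm_shift {s : ℕ × ℕ} (η : X.H s) : ‖X.shift η‖ = ‖η‖ := by
  refine le_antisymm (ContinuousLinearMap.opNorm_le_bound _ (norm_nonneg _) fun f =>
    lp.norm_le_of_forall_sum_le (by norm_num) (by positivity) (X.sum_creationFun_le η f)) ?_
  have := X.norm_symbol_le (X.shift η)
  rwa [symbol_shift, lp.norm_single (by norm_num)] at this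

theorem shift_U_tmul {s t r : ℕ × ℕ} (h : s + t = r) (x : X.H s) (y : X.H t) :
    X.shift (X.U s t r h (x ⊗ₜ y)) = X.shift x * X.shift y :=
  Subtype.ext (X.creation_U_tmul h x y)

theorem shift_Δ : X.shift X.Δ = 1 := by
  apply Subtype.ext
  ext1 f
  have := X.creation_smul_Δ 1 f
  rw [one_smul, one_smul] at this
  exact this

theorem shift_injective {s : ℕ × ℕ} {x y : X.H s} (h : X.shift x = X.shift y) : x = y := by
  rw [← X.symbol_shift_self x, h, symbol_shift_self]

theorem U_surjective {s t r : ℕ × ℕ} (h : s + t = r) : Function.Surjective (X.U s t r h) :=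
  fun η => ⟨_, LinearMap.congr_fun (X.coisometry s t r h) η⟩

/-- A submodule of `X(s + t)` that contains all products is everything. -/
theorem mem_of_U_tmul_mem {s t r : ℕ × ℕ} (h : s + t = r) {K : Submodule ℂ (X.H r)}
    (hK : ∀ (x : X.H s) (y : X.H t), X.U s t r h (x ⊗ₜ y) ∈ K) (η : X.H r) : η ∈ K := by
  obtain ⟨z, rfl⟩ := X.U_surjective h η
  induction z using TensorProduct.induction_on with
  | zero => simp
  | tmul x y => exact hK x y
  | add a b ha hb => rw [map_add]; exact K.add_mem ha hb

/-- Products of the operators `L_η^{(s)}` are again of this form, so their span is dense. -/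
theorem mem_of_shift_mem {K : Submodule ℂ X.tensorAlgebra}
    (hK : IsClosed (K : Set X.tensorAlgebra))
    (h : ∀ (s : ℕ × ℕ) (η : X.H s), X.shift η ∈ K) (T : X.tensorAlgebra) : T ∈ K := by
  have hle : Subalgebra.toSubmodule
      (Algebra.adjoin ℂ {T | ∃ (s : ℕ × ℕ) (η : X.H s), T = X.creation η}) ≤
      K.map X.tensorAlgebra.toSubmodule.subtype := by
    rw [Algebra.adjoin_eq_span, Submodule.span_le]
    intro T hT
    suffices h' : ∃ (s : ℕ × ℕ) (η : X.H s), T = X.creation η by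
      obtain ⟨s, η, rfl⟩ := h'
      exact ⟨X.shift η, h s η, rfl⟩
    induction hT using Submonoid.closure_induction with
    | mem T hT => exact hT
    | one => exact ⟨0, X.Δ, congrArg Subtype.val X.shift_Δ.symm⟩
    | mul S T _ _ hS hT =>
      obtain ⟨s, x, rfl⟩ := hS
      obtain ⟨t, y, rfl⟩ := hT
      exact ⟨s + t, X.U s t _ rfl (x ⊗ₜ y), (X.creation_U_tmul rfl x y).symm⟩
  have hT : T ∈ closure {T : X.tensorAlgebra | (T : X.Fock →L[ℂ] X.Fock) ∈
      Algebra.adjoin ℂ {T | ∃ (s : ℕ × ℕ) (η : X.H s), T = X.creation η}} := by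
    rw [closure_subtype]
    refine closure_mono ?_ T.2
    intro S hS
    exact ⟨⟨S, Subalgebra.le_topologicalClosure _ hS⟩, hS, rfl⟩
  refine closure_minimal ?_ hK hT
  intro S hS
  obtain ⟨S', hS', e⟩ := hle hS
  rwa [← Subtype.ext e]

/-- Two continuous linear maps on the tensor algebra agree if they agree on all `L_η^{(s)}`. -/
theorem ext_of_shift {G : Type*} [AddCommGroup G] [Module ℂ G] [TopologicalSpace G] [T2Space G]
    {f g : X.tensorAlgebra →ₗ[ℂ] G} (hf : Continuous f) (hg : Continuous g)
    (h : ∀ (s : ℕ × ℕ) (η : X.H s), f (X.shift η) = g (X.shift η)) (T : X.tensorAlgebra) :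
    f T = g T :=
  X.mem_of_shift_mem (K := LinearMap.eqLocus f g) (isClosed_eq hf hg) h T

theorem creation_apply_of_not_le {s : ℕ × ℕ} (η : X.H s) (f : X.Fock) {t : ℕ × ℕ}
    (h : ¬ s ≤ t) : X.creation η f t = 0 := by
  rw [creation_apply, creationFun, dif_neg h]

theorem shift_zero (s : ℕ × ℕ) : X.shift (0 : X.H s) = 0 := map_zero (X.shiftₗ s)

/-- Evaluation at a coordinate of the Fock space. -/
abbrev coord (t : ℕ × ℕ) : X.Fock →L[ℂ] X.H t := lp.evalCLM ℂ X.H 2 t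

/-- An element of the tensor algebra acts by the formal product with its value at the vacuum. -/
theorem apply_eq_sum (T : X.tensorAlgebra) (f : X.Fock) (t : ℕ × ℕ) :
    (T : X.Fock →L[ℂ] X.Fock) f t =
      ∑ s ∈ Finset.Iic t, X.creation (X.symbol T s) f t := by
  let L : X.tensorAlgebra →L[ℂ] X.H t := (X.coord t).comp
    ((ContinuousLinearMap.apply ℂ X.Fock f).comp X.tensorAlgebra.toSubmodule.subtypeL)
  let R : X.tensorAlgebra →L[ℂ] X.H t := ∑ s ∈ Finset.Iic t,
    (L.comp (LinearMap.toContinuousLinearMap (X.shiftₗ s))).comp ((X.coord s).comp X.symbol)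
  have hR : ∀ T, R T = ∑ s ∈ Finset.Iic t, X.creation (X.symbol T s) f t := by
    intro T
    simp only [R, sum_apply]
    rfl
  rw [← hR]
  -- Only finitely many s lie below t, so both sides are continuous in T and it is enough to compare
  -- them on generators.
  refine X.ext_of_shift (f := L.toLinearMap) (g := R.toLinearMap) L.continuous R.continuous ?_ T
  intro s η
  change X.creation η f t = R _
  rw [hR]
  by_cases hs : s ≤ t
  · rw [Finset.sum_eq_single s, symbol_shift_self]
    · intro b _ hb
      rw [X.symbol_shift_ne η hb]
      exact congrArg (fun S : X.tensorAlgebra => (S : X.Fock →L[ℂ] X.Fock) f t) (X.shift_zero b)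
    · intro h; exact absurd (Finset.mem_Iic.2 hs) h
  · rw [creation_apply_of_not_le _ _ _ hs, Finset.sum_eq_zero]
    intro b hb
    rw [X.symbol_shift_ne η (by rintro rfl; exact hs (Finset.mem_Iic.1 hb))]
    exact congrArg (fun S : X.tensorAlgebra => (S : X.Fock →L[ℂ] X.Fock) f t) (X.shift_zero b)

theorem symbol_injective {S T : X.tensorAlgebra} (h : X.symbol S = X.symbol T) : S = T := by
  apply Subtype.ext
  ext f t
  rw [apply_eq_sum, apply_eq_sum, h]

/-- All coordinates of total degree less than `k` vanish. -/
def HasOrder (k : ℕ) (f : X.Fock) : Prop := ∀ t : ℕ × ℕ, t.1 + t.2 < k → f t = 0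

variable {X}

theorem HasOrder.apply {k l : ℕ} {T : X.tensorAlgebra} {f : X.Fock}
    (hT : X.HasOrder k (X.symbol T)) (hf : X.HasOrder l f) :
    X.HasOrder (k + l) ((T : X.Fock →L[ℂ] X.Fock) f) := by
  intro t ht
  rw [apply_eq_sum]
  refine Finset.sum_eq_zero fun s hs => ?_
  have hs := Finset.mem_Iic.1 hs
  by_cases hk : s.1 + s.2 < k
  · rw [hT s hk]
    exact congrArg (fun S : X.tensorAlgebra => (S : X.Fock →L[ℂ] X.Fock) f t) (X.shift_zero s)
  · rw [creation_apply, creationFun, dif_pos hs, hf, TensorProduct.tmul_zero, map_zero]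
    have := hs.1
    have := hs.2
    simp only [Prod.fst_sub, Prod.snd_sub]
    omega

theorem HasOrder.mul {k l : ℕ} {S T : X.tensorAlgebra}
    (hS : X.HasOrder k (X.symbol S)) (hT : X.HasOrder l (X.symbol T)) :
    X.HasOrder (k + l) (X.symbol (S * T)) := by
  rw [symbol_mul]
  exact hS.apply hT

theorem HasOrder.pow {T : X.tensorAlgebra} (hT : X.HasOrder 1 (X.symbol T)) (n : ℕ) :
    X.HasOrder n (X.symbol (T ^ n)) := by
  induction n with
  | zero => intro t ht; exact absurd ht (Nat.not_lt_zero _)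
  | succ n ih => rw [pow_succ]; exact ih.mul hT

theorem HasOrder.mono {k l : ℕ} (h : l ≤ k) {f : X.Fock} (hf : X.HasOrder k f) : X.HasOrder l f :=
  fun t ht => hf t (ht.trans_le h)

theorem eq_zero_of_add_lt_one {t : ℕ × ℕ} (ht : t.1 + t.2 < 1) : t = 0 := by
  ext <;> simp <;> omega

theorem hasOrder_one_iff {f : X.Fock} : X.HasOrder 1 f ↔ f 0 = 0 := by
  refine ⟨fun h => h 0 (by simp), fun h t ht => ?_⟩
  obtain rfl := eq_zero_of_add_lt_one ht
  exact h

theorem vacuumCharacter_apply (T : X.tensorAlgebra) :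
    X.vacuumCharacter T = inner ℂ X.Δ (X.symbol T 0) := X.inner_vacuum _

/-- The degree zero fibre is spanned by Δ, so the character sees the whole constant term. This turns
the hypothesis on vacuum characters into a statement about orders. -/
theorem hasOrder_one_iff_vacuumCharacter {T : X.tensorAlgebra} :
    X.HasOrder 1 (X.symbol T) ↔ X.vacuumCharacter T = 0 := by
  rw [hasOrder_one_iff, vacuumCharacter_apply]
  obtain ⟨c, hc⟩ := X.exists_eq_smul_Δ (X.symbol T 0)
  rw [hc, inner_smul_right, inner_self_eq_norm_sq_to_K, X.norm_Δ]
  simp only [RCLike.ofReal_one, one_pow, mul_one]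
  refine ⟨fun h => ?_, fun h => by rw [h, zero_smul]⟩
  have := congrArg norm h
  rw [norm_smul, X.norm_Δ, mul_one, norm_zero] at this
  exact norm_eq_zero.1 this

/-- Every index other than zero can be decreased in one of the two directions. -/
theorem index_induction {p : ℕ × ℕ → Prop} (zero : p 0)
    (step : ∀ d t s : ℕ × ℕ, (d = (1, 0) ∨ d = (0, 1)) → d + t = s → p t → p s)
    (s : ℕ × ℕ) : p s := by
  obtain ⟨a, b⟩ := s
  induction a with
  | zero =>
    induction b with
    | zero => exact zero
    | succ b ih => exact step (0, 1) (0, b) _ (Or.inr rfl) (by ext <;> simp; omega) ih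
  | succ a ih => exact step (1, 0) (a, b) _ (Or.inl rfl) (by ext <;> simp; omega) ih

end Structure

/-! ### Vacuum preserving homomorphisms and the filtration. -/

section Homomorphisms

variable {X : SubproductSystem.{u}} {Y : SubproductSystem.{v}}

/-- If a homomorphism sends the generators of degree one to operators `L`, along an additive map of
the indices, then it does so in all degrees. -/
theorem exists_map_shift_eq (θ : X.tensorAlgebra →ₐ[ℂ] Y.tensorAlgebra)
    (σ : ℕ × ℕ →+ ℕ × ℕ)
    (h : ∀ d : ℕ × ℕ, (d = (1, 0) ∨ d = (0, 1)) → ∀ x : X.H d, ∃ y : Y.H (σ d),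
      θ (X.shift x) = Y.shift y) (s : ℕ × ℕ) :
    ∀ x : X.H s, ∃ y : Y.H (σ s), θ (X.shift x) = Y.shift y := by
  -- The claim is recast as membership in a submodule, so that it can be checked on products alone.
  suffices hs : ∀ x : X.H s, x ∈
      (LinearMap.range (Y.shiftₗ (σ s))).comap (θ.toLinearMap ∘ₗ X.shiftₗ s) by
    intro x
    obtain ⟨y, hy⟩ := hs x
    exact ⟨y, hy.symm⟩
  induction s using index_induction with
  | zero =>
    intro x
    obtain ⟨c, rfl⟩ := X.exists_eq_smul_Δ x
    refine Submodule.smul_mem _ _ ?_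
    rw [map_zero]
    exact ⟨Y.Δ, by simp [shift_Δ]⟩
  | step d t s hd hs ih =>
    refine X.mem_of_U_tmul_mem hs fun x y => ?_
    obtain ⟨x', hx'⟩ := h d hd x
    obtain ⟨y', hy'⟩ := ih y
    refine ⟨Y.U _ _ (σ s) (by rw [← map_add, hs]) (x' ⊗ₜ y'), ?_⟩
    simp only [shiftₗ_apply, LinearMap.comp_apply, AlgHom.toLinearMap_apply] at hy' ⊢
    rw [shift_U_tmul, shift_U_tmul, map_mul, hx', hy']

/-- A homomorphism that preserves the vacuum characters does not decrease degrees. -/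
theorem hasOrder_map_shift (θ : X.tensorAlgebra →ₐ[ℂ] Y.tensorAlgebra)
    (hθ : Y.vacuumCharacter.comp θ = X.vacuumCharacter) {s : ℕ × ℕ} :
    ∀ η : X.H s, Y.HasOrder (s.1 + s.2) (Y.symbol (θ (X.shift η))) := by
  suffices hs : ∀ η : X.H s, η ∈ ⨅ t : {t : ℕ × ℕ // t.1 + t.2 < s.1 + s.2}, LinearMap.ker
      ((Y.coord t.1).toLinearMap ∘ₗ Y.symbol.toLinearMap ∘ₗ θ.toLinearMap ∘ₗ X.shiftₗ s) by
    intro η t ht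
    exact (Submodule.mem_iInf _).1 (hs η) ⟨t, ht⟩
  induction s using index_induction with
  | zero =>
    intro η
    rw [Submodule.mem_iInf]
    rintro ⟨t, ht⟩
    exact absurd ht (Nat.not_lt_zero _)
  | step d t s hd hs ih =>
    refine X.mem_of_U_tmul_mem hs fun x y => ?_
    rw [Submodule.mem_iInf]
    rintro ⟨r, hr⟩
    have hy : Y.HasOrder (t.1 + t.2) (Y.symbol (θ (X.shift y))) := fun r hr =>
      (Submodule.mem_iInf _).1 (ih y) ⟨r, hr⟩
    have hx : Y.HasOrder 1 (Y.symbol (θ (X.shift x))) := by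
      rw [hasOrder_one_iff_vacuumCharacter]
      have := DFunLike.congr_fun hθ (X.shift x)
      rw [X.vacuumCharacter_shift (by rcases hd with rfl | rfl <;> simp)] at this
      exact this
    have hxy := hx.mul hy
    rw [← map_mul, ← shift_U_tmul X hs] at hxy
    refine hxy r (hr.trans_le (le_of_eq ?_))
    subst hs
    rcases hd with rfl | rfl <;> simp <;> omega

/-- A bounded vacuum preserving homomorphism preserves the elements of order two. -/
theorem HasOrder.map_two (θ : X.tensorAlgebra →ₐ[ℂ] Y.tensorAlgebra) (hc : Continuous θ)
    (hθ : Y.vacuumCharacter.comp θ = X.vacuumCharacter) {T : X.tensorAlgebra}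
    (hT : X.HasOrder 2 (X.symbol T)) : Y.HasOrder 2 (Y.symbol (θ T)) := by
  let D : Finset (ℕ × ℕ) := {0, (1, 0), (0, 1)}
  have hD : ∀ s : ℕ × ℕ, s ∈ D ↔ s.1 + s.2 < 2 := by
    rintro ⟨a, b⟩
    simp only [D, Finset.mem_insert, Finset.mem_singleton, Prod.mk.injEq, Prod.mk_eq_zero]
    omega
  -- Truncation to total degree less than two. A coordinate of the image of total degree less than
  -- two depends only on this truncation, by continuity and `hasOrder_map_shift`.
  let P : X.tensorAlgebra →L[ℂ] X.tensorAlgebra := ∑ s ∈ D,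
    (LinearMap.toContinuousLinearMap (X.shiftₗ s)).comp ((X.coord s).comp X.symbol)
  have hP : ∀ T, P T = ∑ s ∈ D, X.shift (X.symbol T s) := by
    intro T
    simp only [P, sum_apply]
    rfl
  intro t ht
  let G : X.tensorAlgebra →L[ℂ] Y.H t :=
    (Y.coord t).comp (Y.symbol.comp ⟨θ.toLinearMap, hc⟩)
  have h0 : ∀ T, G T = G (P T) := X.ext_of_shift (f := G.toLinearMap)
    (g := (G.comp P).toLinearMap) G.continuous (G.comp P).continuous (by
      intro s η
      change G _ = G (P _)
      rw [hP]
      by_cases hs : s ∈ D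
      · rw [Finset.sum_eq_single_of_mem s hs, symbol_shift_self]
        intro b _ hb
        rw [X.symbol_shift_ne η hb, shift_zero]
      · rw [Finset.sum_eq_zero, map_zero]
        · rw [hD, not_lt] at hs
          exact (hasOrder_map_shift θ hθ η).mono hs t ht
        · intro b hb
          rw [X.symbol_shift_ne η (by rintro rfl; exact hs hb), shift_zero])
  change G T = 0
  rw [h0, hP, Finset.sum_eq_zero, map_zero]
  intro s hs
  rw [hT s ((hD s).1 hs), shift_zero]

end Homomorphisms

/-! ### Graded characters and the Schwarz lemma. -/

/-- A functional on the range of a coisometry is bounded by the norms of the factors if it pulls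
back to a product functional. -/
theorem _root_.LinearMap.norm_le_of_coisometry {E F G : Type*}
    [NormedAddCommGroup E] [InnerProductSpace ℂ E] [FiniteDimensional ℂ E]
    [NormedAddCommGroup F] [InnerProductSpace ℂ F] [FiniteDimensional ℂ F]
    [NormedAddCommGroup G] [InnerProductSpace ℂ G] [FiniteDimensional ℂ G]
    {U : E ⊗[ℂ] F →ₗ[ℂ] G} (hU : U ∘ₗ LinearMap.adjoint U = LinearMap.id)
    {f : E →ₗ[ℂ] ℂ} {g : F →ₗ[ℂ] ℂ} {h : G →ₗ[ℂ] ℂ} (hfg : ∀ x y, h (U (x ⊗ₜ y)) = f x * g y)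
    {C D : ℝ} (hC : 0 ≤ C) (hD : 0 ≤ D) (hf : ∀ x, ‖f x‖ ≤ C * ‖x‖) (hg : ∀ x, ‖g x‖ ≤ D * ‖x‖)
    (x : G) : ‖h x‖ ≤ C * D * ‖x‖ := by
  have := FiniteDimensional.complete ℂ E
  have := FiniteDimensional.complete ℂ F
  obtain ⟨a, ha⟩ := (InnerProductSpace.toDual ℂ E).surjective (LinearMap.toContinuousLinearMap f)
  obtain ⟨b, hb⟩ := (InnerProductSpace.toDual ℂ F).surjective (LinearMap.toContinuousLinearMap g)
  have ha' : ‖a‖ ≤ C := by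
    rw [← (InnerProductSpace.toDual ℂ E).norm_map, ha]
    exact ContinuousLinearMap.opNorm_le_bound _ hC hf
  have hb' : ‖b‖ ≤ D := by
    rw [← (InnerProductSpace.toDual ℂ F).norm_map, hb]
    exact ContinuousLinearMap.opNorm_le_bound _ hD hg
  -- With Riesz vectors a and b of the two factors, the pullback is represented by a ⊗ b, whose norm
  -- is the product; evaluation at U*x loses nothing because U* is isometric.
  have hz : ∀ z, h (U z) = inner ℂ (a ⊗ₜ[ℂ] b) z := by
    intro z
    induction z using TensorProduct.induction_on with
    | zero => simp
    | tmul x y =>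
      rw [hfg, TensorProduct.inner_tmul]
      exact (congrArg₂ (· * ·) (DFunLike.congr_fun ha x) (DFunLike.congr_fun hb y)).symm
    | add x y hx hy => rw [map_add, map_add, hx, hy, inner_add_right]
  have hx : U (LinearMap.adjoint U x) = x := LinearMap.congr_fun hU x
  have hn : ‖LinearMap.adjoint U x‖ = ‖x‖ := by
    have h1 := LinearMap.adjoint_inner_right U (LinearMap.adjoint U x) x
    rw [hx, inner_self_eq_norm_sq_to_K, inner_self_eq_norm_sq_to_K] at h1
    exact (pow_left_inj₀ (norm_nonneg _) (norm_nonneg _) two_ne_zero).1 (by exact_mod_cast h1)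
  have h1 := norm_inner_le_norm (𝕜 := ℂ) (a ⊗ₜ[ℂ] b) (LinearMap.adjoint U x)
  rw [← hz, hx, hn, TensorProduct.norm_tmul] at h1
  exact h1.trans (by gcongr)

/-- A multiplicative family of functionals on the fibres of `X`: the restriction of a (possibly
unbounded) character of the tensor algebra to the fibres. -/
structure GradedCharacter (X : SubproductSystem.{u}) where
  val : ∀ s, X.H s →ₗ[ℂ] ℂ
  map_Δ : val 0 X.Δ = 1
  map_U : ∀ (s t r : ℕ × ℕ) (h : s + t = r) (x : X.H s) (y : X.H t),
    val r (X.U s t r h (x ⊗ₜ y)) = val s x * val t y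

namespace GradedCharacter

variable {X : SubproductSystem.{u}} (ψ : X.GradedCharacter)

/-- It suffices to check multiplicativity for left factors of degree one. -/
def ofLeftMul (val : ∀ s, X.H s →ₗ[ℂ] ℂ) (map_Δ : val 0 X.Δ = 1)
    (h : ∀ d : ℕ × ℕ, (d = (1, 0) ∨ d = (0, 1)) → ∀ (t r : ℕ × ℕ) (h : d + t = r)
      (x : X.H d) (y : X.H t), val r (X.U d t r h (x ⊗ₜ y)) = val d x * val t y) :
    X.GradedCharacter where
  val := val
  map_Δ := map_Δ
  map_U s := by
    induction s using index_induction with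
    | zero =>
      intro t r h x y
      obtain rfl : t = r := by rw [← h, zero_add]
      obtain ⟨c, rfl⟩ := X.exists_eq_smul_Δ x
      rw [← TensorProduct.smul_tmul', map_smul, map_smul, X.unit_mul, map_smul, map_Δ]
      simp
    | step d s' s hd hs ih =>
      intro t r hr x y
      suffices hx : x ∈ LinearMap.eqLocus
          (val r ∘ₗ X.U s t r hr ∘ₗ (TensorProduct.mk ℂ (X.H s) (X.H t)).flip y)
          (val t y • val s) by
        exact hx.trans (mul_comm _ _)
      refine X.mem_of_U_tmul_mem hs (fun a b => ?_) x
      have hr' : d + (s' + t) = r := by rw [← add_assoc, hs, hr]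
      change val r (X.U s t r hr (X.U d s' s hs (a ⊗ₜ b) ⊗ₜ y)) =
        val t y * val s (X.U d s' s hs (a ⊗ₜ b))
      rw [X.assoc d s' t s (s' + t) r hs hr rfl hr', h d hd, h d hd, ih]
      ring

theorem norm_U_le {s t r : ℕ × ℕ} (h : s + t = r) {C D : ℝ} (hC : 0 ≤ C) (hD : 0 ≤ D)
    (hs : ∀ x, ‖ψ.val s x‖ ≤ C * ‖x‖) (ht : ∀ x, ‖ψ.val t x‖ ≤ D * ‖x‖) (x : X.H r) :
    ‖ψ.val r x‖ ≤ C * D * ‖x‖ :=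
  LinearMap.norm_le_of_coisometry (X.coisometry s t r h) (ψ.map_U s t r h) hC hD hs ht x

/-- Multiplication maps are coisometries, so norms of the functionals are submultiplicative along
sums of indices; each step of degree one costs a factor M. -/
theorem norm_val_le {M : ℝ} (hM : 0 ≤ M) (h₁ : ∀ x, ‖ψ.val (1, 0) x‖ ≤ M * ‖x‖)
    (h₂ : ∀ x, ‖ψ.val (0, 1) x‖ ≤ M * ‖x‖) (s : ℕ × ℕ) :
    ∀ x, ‖ψ.val s x‖ ≤ M ^ (s.1 + s.2) * ‖x‖ := by
  induction s using index_induction with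
  | zero =>
    intro x
    obtain ⟨c, rfl⟩ := X.exists_eq_smul_Δ x
    rw [map_smul, ψ.map_Δ, norm_smul c X.Δ, X.norm_Δ]
    simp
  | step d t s hd hs ih =>
    intro x
    have hd' : ∀ x, ‖ψ.val d x‖ ≤ M * ‖x‖ := by
      rcases hd with rfl | rfl
      exacts [h₁, h₂]
    have e : s.1 + s.2 = t.1 + t.2 + 1 := by
      subst hs
      rcases hd with rfl | rfl <;> simp <;> omega
    rw [e, pow_succ']
    exact ψ.norm_U_le hs hM (by positivity) hd' ih x

/-- The sum of the values on the coordinates of total degree `n`. -/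
def coef (n : ℕ) : X.tensorAlgebra →L[ℂ] ℂ :=
  ∑ t ∈ Finset.HasAntidiagonal.antidiagonal n,
    (LinearMap.toContinuousLinearMap (ψ.val t)).comp ((X.coord t).comp X.symbol)

theorem coef_apply (n : ℕ) (T : X.tensorAlgebra) :
    ψ.coef n T = ∑ t ∈ Finset.HasAntidiagonal.antidiagonal n, ψ.val t (X.symbol T t) := by
  simp only [coef, sum_apply]
  rfl

theorem coef_shift (n : ℕ) {s : ℕ × ℕ} (η : X.H s) :
    ψ.coef n (X.shift η) = if s.1 + s.2 = n then ψ.val s η else 0 := by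
  rw [coef_apply]
  split_ifs with h
  · rw [Finset.sum_eq_single_of_mem s (Finset.HasAntidiagonal.mem_antidiagonal.2 h), symbol_shift_self]
    intro b _ hb
    rw [X.symbol_shift_ne η hb, map_zero]
  · refine Finset.sum_eq_zero fun b hb => ?_
    rw [X.symbol_shift_ne η (by rintro rfl; exact h (Finset.HasAntidiagonal.mem_antidiagonal.1 hb)), map_zero]

theorem coef_eq_zero {k n : ℕ} {T : X.tensorAlgebra} (hT : X.HasOrder k (X.symbol T))
    (hn : n < k) : ψ.coef n T = 0 := by
  rw [coef_apply]
  refine Finset.sum_eq_zero fun t ht => ?_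
  rw [hT t (by rwa [Finset.HasAntidiagonal.mem_antidiagonal.1 ht]), map_zero]

/-- The Cauchy product rule: total degree is additive and ψ is multiplicative on fibres. Density
reduces first the right factor, then the left one, to generators. -/
theorem coef_mul (n : ℕ) (S T : X.tensorAlgebra) :
    ψ.coef n (S * T) = ∑ p ∈ Finset.HasAntidiagonal.antidiagonal n, ψ.coef p.1 S * ψ.coef p.2 T := by
  have key : ∀ (s : ℕ × ℕ) (x : X.H s) (T : X.tensorAlgebra), ψ.coef n (X.shift x * T) =
      ∑ p ∈ Finset.HasAntidiagonal.antidiagonal n, ψ.coef p.1 (X.shift x) * ψ.coef p.2 T := by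
    intro s x T
    let f : X.tensorAlgebra →ₗ[ℂ] ℂ :=
      (ψ.coef n).toLinearMap ∘ₗ LinearMap.mulLeft ℂ (X.shift x)
    let g : X.tensorAlgebra →L[ℂ] ℂ :=
      ∑ p ∈ Finset.HasAntidiagonal.antidiagonal n, ψ.coef p.1 (X.shift x) • ψ.coef p.2
    have hg : ∀ T, g T = ∑ p ∈ Finset.HasAntidiagonal.antidiagonal n,
        ψ.coef p.1 (X.shift x) * ψ.coef p.2 T := by
      intro T
      simp only [g, sum_apply]
      rfl
    rw [← hg]
    refine X.ext_of_shift (f := f) (g := g.toLinearMap)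
      ((ψ.coef n).continuous.comp (continuous_const.mul continuous_id)) g.continuous ?_ T
    intro t y
    change ψ.coef n (X.shift x * X.shift y) = g _
    rw [hg, ← X.shift_U_tmul rfl x y, coef_shift]
    simp only [coef_shift, ite_mul, mul_ite, zero_mul, mul_zero]
    have e : (s + t).1 + (s + t).2 = (s.1 + s.2) + (t.1 + t.2) := by simp; omega
    rw [e]
    split_ifs with h
    · rw [Finset.sum_eq_single_of_mem (s.1 + s.2, t.1 + t.2) (Finset.HasAntidiagonal.mem_antidiagonal.2 h)]
      · simp [ψ.map_U]
      · rintro ⟨a, b⟩ _ hp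
        split_ifs with h1 h2
        · exact absurd (Prod.ext h2.symm h1.symm) hp
        · rfl
        · rfl
    · refine (Finset.sum_eq_zero ?_).symm
      rintro ⟨a, b⟩ hp
      have hp := Finset.HasAntidiagonal.mem_antidiagonal.1 hp
      split_ifs with h1 h2
      · exact absurd (by rw [h1, h2]; exact hp) h
      · rfl
      · rfl
  let f : X.tensorAlgebra →ₗ[ℂ] ℂ := (ψ.coef n).toLinearMap ∘ₗ LinearMap.mulRight ℂ T
  let g : X.tensorAlgebra →L[ℂ] ℂ := ∑ p ∈ Finset.HasAntidiagonal.antidiagonal n, ψ.coef p.2 T • ψ.coef p.1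
  have hg : ∀ S, g S = ∑ p ∈ Finset.HasAntidiagonal.antidiagonal n, ψ.coef p.1 S * ψ.coef p.2 T := by
    intro S
    simp only [g, sum_apply]
    exact Finset.sum_congr rfl fun p _ => mul_comm _ _
  rw [← hg]
  refine X.ext_of_shift (f := f) (g := g.toLinearMap)
    ((ψ.coef n).continuous.comp (continuous_id.mul continuous_const)) g.continuous ?_ S
  intro s x
  exact (key s x T).trans (hg _).symm

/-- In the Cauchy product every term but one has a factor below the order of S or of T, so leading
coefficients multiply. -/
theorem coef_mul_of_hasOrder {k l : ℕ} {S T : X.tensorAlgebra}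
    (hS : X.HasOrder k (X.symbol S)) (hT : X.HasOrder l (X.symbol T)) :
    ψ.coef (k + l) (S * T) = ψ.coef k S * ψ.coef l T := by
  rw [coef_mul, Finset.sum_eq_single_of_mem (k, l) (Finset.HasAntidiagonal.mem_antidiagonal.2 rfl)]
  rintro ⟨a, b⟩ hp hne
  have hp : a + b = k + l := Finset.HasAntidiagonal.mem_antidiagonal.1 hp
  rcases lt_trichotomy a k with h | h | h
  · rw [ψ.coef_eq_zero hS h, zero_mul]
  · subst h
    exact absurd (by rw [add_left_cancel hp]) hne
  · rw [ψ.coef_eq_zero hT (show b < l by omega), mul_zero]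

theorem coef_one (n : ℕ) : ψ.coef n 1 = if n = 0 then 1 else 0 := by
  rw [← X.shift_Δ, coef_shift, ψ.map_Δ]
  simp [eq_comm]

theorem coef_pow {T : X.tensorAlgebra} (hT : X.HasOrder 1 (X.symbol T)) (n : ℕ) :
    ψ.coef n (T ^ n) = ψ.coef 1 T ^ n := by
  induction n with
  | zero => rw [pow_zero, pow_zero, coef_one, if_pos rfl]
  | succ n ih => rw [pow_succ, pow_succ, ψ.coef_mul_of_hasOrder (hT.pow n) hT, ih]

/-- The factor n + 1 counts the indices of total degree n. Being subexponential, it disappears when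
powers of T are compared. -/
theorem norm_coef_le {M : ℝ} (hM : 0 ≤ M) (h₁ : ∀ x, ‖ψ.val (1, 0) x‖ ≤ M * ‖x‖)
    (h₂ : ∀ x, ‖ψ.val (0, 1) x‖ ≤ M * ‖x‖) (n : ℕ) (T : X.tensorAlgebra) :
    ‖ψ.coef n T‖ ≤ (n + 1) * (M ^ n * ‖T‖) := by
  rw [coef_apply]
  refine (norm_sum_le_of_le (Finset.HasAntidiagonal.antidiagonal n) (f := fun t => ψ.val t (X.symbol T t))
    (n := fun _ => M ^ n * ‖T‖) ?_).trans ?_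
  · intro t ht
    refine (ψ.norm_val_le hM h₁ h₂ t _).trans ?_
    rw [Finset.HasAntidiagonal.mem_antidiagonal.1 ht]
    gcongr
    exact (lp.norm_apply_le_norm two_ne_zero _ _).trans (X.norm_symbol_le T)
  · rw [Finset.sum_const, Finset.Nat.card_antidiagonal, nsmul_eq_mul]
    push_cast
    rfl

theorem _root_.le_of_forall_pow_le_succ_mul_pow {a b : ℝ} (hb : 0 ≤ b)
    (h : ∀ n : ℕ, a ^ n ≤ (n + 1) * b ^ n) : a ≤ b := by
  by_contra! hab
  have ha : 0 < a := hb.trans_lt hab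
  have hr : b / a < 1 := (div_lt_one ha).2 hab
  have hr0 : 0 ≤ b / a := by positivity
  have h1 := tendsto_self_mul_const_pow_of_lt_one hr0 hr
  have h2 := tendsto_pow_atTop_nhds_zero_of_lt_one hr0 hr
  have h3 := h1.add h2
  rw [add_zero] at h3
  -- If b < a, then (n + 1)(b/a)ⁿ tends to 0 but stays at least 1.
  have h4 : ∀ n : ℕ, 1 ≤ (n : ℝ) * (b / a) ^ n + (b / a) ^ n := by
    intro n
    have := h n
    rw [div_pow, ← add_one_mul, ← mul_div_assoc, le_div_iff₀ (by positivity), one_mul]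
    exact this
  exact absurd (ge_of_tendsto' h3 h4) (by norm_num)

/-- The Schwarz lemma for elements of the tensor algebra that vanish at the vacuum character. -/
theorem norm_coef_one_le {M : ℝ} (hM : 0 ≤ M) (h₁ : ∀ x, ‖ψ.val (1, 0) x‖ ≤ M * ‖x‖)
    (h₂ : ∀ x, ‖ψ.val (0, 1) x‖ ≤ M * ‖x‖) {T : X.tensorAlgebra}
    (hT : X.HasOrder 1 (X.symbol T)) : ‖ψ.coef 1 T‖ ≤ M * ‖T‖ := by
  refine le_of_forall_pow_le_succ_mul_pow (by positivity) fun n => ?_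
  rw [← norm_pow, ← ψ.coef_pow hT]
  refine (ψ.norm_coef_le hM h₁ h₂ n _).trans ?_
  rw [mul_pow]
  gcongr
  -- The power zero is separate: it needs that the identity has norm at most 1, which comes from the
  -- generator of Δ.
  rcases n.eq_zero_or_pos with rfl | hn
  · rw [pow_zero, pow_zero]
    have := X.norm_shift X.Δ
    rw [shift_Δ, X.norm_Δ] at this
    exact this.le
  · exact norm_pow_le' T hn

/-- The leading terms of the pullback of `ψ` along a vacuum preserving homomorphism. -/
def comap {Y : SubproductSystem.{v}} (θ : Y.tensorAlgebra →ₐ[ℂ] X.tensorAlgebra)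
    (hθ : X.vacuumCharacter.comp θ = Y.vacuumCharacter) : Y.GradedCharacter where
  val s := (ψ.coef (s.1 + s.2)).toLinearMap ∘ₗ θ.toLinearMap ∘ₗ Y.shiftₗ s
  map_Δ := by
    change ψ.coef 0 (θ (Y.shift Y.Δ)) = 1
    rw [shift_Δ, map_one, coef_one, if_pos rfl]
  map_U := by
    intro s t r h x y
    change ψ.coef (r.1 + r.2) (θ (Y.shift _)) = ψ.coef _ (θ (Y.shift x)) * ψ.coef _ (θ (Y.shift y))
    have e : r.1 + r.2 = (s.1 + s.2) + (t.1 + t.2) := by subst h; simp; omega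
    rw [shift_U_tmul, map_mul, e,
      ψ.coef_mul_of_hasOrder (hasOrder_map_shift θ hθ x) (hasOrder_map_shift θ hθ y)]

theorem comap_val {Y : SubproductSystem.{v}} (θ : Y.tensorAlgebra →ₐ[ℂ] X.tensorAlgebra)
    (hθ : X.vacuumCharacter.comp θ = Y.vacuumCharacter) {s : ℕ × ℕ} (η : Y.H s) :
    (ψ.comap θ hθ).val s η = ψ.coef (s.1 + s.2) (θ (Y.shift η)) := rfl

/-- The action of the torus, and of its closure. -/
def scale (a b : ℂ) : X.GradedCharacter where
  val s := (a ^ s.1 * b ^ s.2) • ψ.val s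
  map_Δ := by simp [ψ.map_Δ]
  map_U := by
    intro s t r h x y
    subst h
    simp only [LinearMap.smul_apply, ψ.map_U, smul_eq_mul, Prod.fst_add, Prod.snd_add, pow_add]
    ring

end GradedCharacter

end SubproductSystem
end

/-! ### Norm geometry of products with the maximum norm. -/

section

variable {E F E' F' : Type*} [NormedAddCommGroup E] [NormedSpace ℂ E]
  [NormedAddCommGroup F] [NormedSpace ℂ F] [NormedAddCommGroup E'] [NormedSpace ℂ E']
  [NormedAddCommGroup F'] [NormedSpace ℂ F']

/-- Strict convexity, read off from the parallelogram law after passing to Riesz vectors. -/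
theorem eq_zero_of_norm_add_le_of_norm_sub_le_dual {G : Type*} [NormedAddCommGroup G]
    [InnerProductSpace ℂ G] [CompleteSpace G] {x y : StrongDual ℂ G} (h₁ : ‖x + y‖ ≤ ‖x‖)
    (h₂ : ‖x - y‖ ≤ ‖x‖) : y = 0 := by
  let Φ := (InnerProductSpace.toDual ℂ G).symm
  have h := parallelogram_law_with_norm ℂ (Φ x) (Φ y)
  rw [← map_add, ← map_sub] at h
  simp only [Φ.norm_map] at h
  have := norm_nonneg (x + y)
  have := norm_nonneg (x - y)
  exact norm_eq_zero.1 (by nlinarith [norm_nonneg y])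

/-- A linear bijection between products with the maximum norm, that preserves the norm on a subset
stable under scalings of the two coordinates, sends each vector `(z, 0)` of the subset to one of
the two factors. -/
theorem fst_eq_zero_or_snd_eq_zero_of_norm_preserving
    (hE : ∀ x y : E, ‖x + y‖ ≤ ‖x‖ → ‖x - y‖ ≤ ‖x‖ → y = 0)
    (B : E' × F' →ₗ[ℂ] E × F) {W : Set (E' × F')}
    (hW : ∀ v ∈ W, ∀ a b : ℂ, (a • v.1, b • v.2) ∈ W) (hB : ∀ v ∈ W, ‖B v‖ = ‖v‖)
    {v : E' × F'} (hv : v ∈ W) {z : E} (hz : B v = (z, 0)) : v.1 = 0 ∨ v.2 = 0 := by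
  by_contra! hne
  obtain ⟨p, q⟩ := v
  simp only [ne_eq] at hne hW hv hz
  have hp : 0 < ‖p‖ := norm_pos_iff.2 hne.1
  have hq : 0 < ‖q‖ := norm_pos_iff.2 hne.2
  obtain ⟨⟨x₁, x₂⟩, hx⟩ : ∃ x, B (p, 0) = x := ⟨_, rfl⟩
  obtain ⟨⟨y₁, y₂⟩, hy⟩ : ∃ y, B (0, q) = y := ⟨_, rfl⟩
  have hxy : x₂ + y₂ = 0 := by
    have : B (p, q) = B (p, 0) + B (0, q) := by rw [← map_add]; simp
    rw [hx, hy, hz] at this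
    exact (congrArg Prod.snd this).symm
  -- The second components of the images of (p, 0) and (0, q) cancel, which is why a − b multiplies
  -- x₂.
  have key : ∀ a b : ℂ, ‖(a • x₁ + b • y₁, (a - b) • x₂)‖ = max (‖a‖ * ‖p‖) (‖b‖ * ‖q‖) := by
    intro a b
    have h1 : B (a • p, b • q) = (a • x₁ + b • y₁, (a - b) • x₂) := by
      have : (a • p, b • q) = a • (p, (0 : F')) + b • ((0 : E'), q) := by simp
      rw [this, map_add, map_smul, map_smul, hx, hy, eq_neg_of_add_eq_zero_right hxy]
      simp only [add_smul, neg_smul, smul_neg, Prod.smul_mk, Prod.mk_add_mk, sub_eq_add_neg]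
    rw [← h1, hB _ (hW _ hv a b), Prod.norm_def, norm_smul, norm_smul]
  -- This k balances the two scaled vectors: p and ±k q have the same norm, so the images for (1,
  -- ±k) have norm exactly that of p.
  set k : ℝ := ‖p‖ / ‖q‖ with hk
  have hk0 : 0 < k := by positivity
  have hkq : k * ‖q‖ = ‖p‖ := by rw [hk]; field_simp
  have nk : ‖(k : ℂ)‖ = k := by rw [Complex.norm_real, Real.norm_of_nonneg hk0.le]
  have h1 := key 1 k
  have h2 := key 1 (-k)
  have h3 := key 1 0
  have h4 := key 0 1
  simp only [norm_neg, nk, norm_one, one_mul, hkq, max_self, one_smul, neg_smul, sub_neg_eq_add,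
    zero_smul, zero_add, add_zero, zero_sub, sub_zero, norm_zero, zero_mul, Prod.norm_def,
    norm_smul] at h1 h2 h3 h4
  rw [max_eq_left hp.le] at h3
  rw [max_eq_right hq.le] at h4
  have n1 : ‖(1 : ℂ) + k‖ = 1 + k := by
    rw [← Complex.ofReal_one, ← Complex.ofReal_add, Complex.norm_real, Real.norm_of_nonneg]
    positivity
  rw [n1] at h2
  have hx₂ : (1 + k) * ‖x₂‖ ≤ ‖p‖ := (le_max_right _ _).trans h2.le
  have hx₂' : ‖x₂‖ < ‖p‖ := by
    rcases (norm_nonneg x₂).eq_or_lt with h | h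
    · rwa [← h]
    · nlinarith
  have hx₁ : ‖x₁‖ = ‖p‖ := by
    rcases max_choice ‖x₁‖ ‖x₂‖ with h | h
    · rw [← h, h3]
    · rw [h] at h3; exact absurd h3 hx₂'.ne
  -- Since x₂ is too short, x₁ carries the full norm of p, while x₁ ± k y₁ are no longer than x₁;
  -- strict convexity kills y₁.
  have hy₁ : (k : ℂ) • y₁ = 0 := by
    refine hE x₁ _ ?_ ?_
    · rw [hx₁]; exact (le_max_left _ _).trans h1.le
    · rw [hx₁, sub_eq_add_neg]; exact (le_max_left _ _).trans h2.le
  have hy₁ : y₁ = 0 := (smul_eq_zero.1 hy₁).resolve_left (by exact_mod_cast hk0.ne')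
  rw [hy₁, norm_zero, max_eq_right (norm_nonneg _)] at h4
  have : ‖x₂‖ = ‖q‖ := h4
  -- Now x₂ has the norm of q, so (1 + k)‖q‖ ≤ ‖p‖ = k‖q‖, against q ≠ 0.
  nlinarith

/-- If the product of two linear maps vanishes pointwise, one of them is zero. -/
theorem forall_eq_zero_or_forall_eq_zero {G : Type*} [AddCommGroup G] [Module ℂ G]
    {P : G →ₗ[ℂ] E} {Q : G →ₗ[ℂ] F} (h : ∀ z, P z = 0 ∨ Q z = 0) :
    (∀ z, P z = 0) ∨ (∀ z, Q z = 0) := by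
  by_contra! hne
  obtain ⟨⟨x, hx⟩, y, hy⟩ := hne
  have hQx := (h x).resolve_left hx
  have hPy := (h y).resolve_right hy
  rcases h (x + y) with h | h
  · rw [map_add, hPy, add_zero] at h; exact hx h
  · rw [map_add, hQx, zero_add] at h; exact hy h

end

/-! ### Graded characters of good subproduct systems. -/

noncomputable section

namespace SubproductSystem

theorem isBihomogeneous_tensorPoly {m n i j : ℕ} (a : (Fin i → Fin m) → (Fin j → Fin n) → ℂ) :
    IsBihomogeneous (tensorPoly a) i j := by
  unfold IsBihomogeneous tensorPoly
  set w : Fin m ⊕ Fin n → ℕ × ℕ := Sum.elim (fun _ => (1, 0)) fun _ => (0, 1) with hw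
  refine (MvPolynomial.weightedHomogeneousSubmodule ℂ w (i, j)).sum_mem fun s _ =>
    (MvPolynomial.weightedHomogeneousSubmodule ℂ w (i, j)).sum_mem fun t _ => ?_
  rw [MvPolynomial.mem_weightedHomogeneousSubmodule]
  have h1 : MvPolynomial.IsWeightedHomogeneous w
      (∏ k, MvPolynomial.X (Sum.inl (s k)) : MvPolynomial (Fin m ⊕ Fin n) ℂ) (i, 0) := by
    have := MvPolynomial.IsWeightedHomogeneous.prod (w := w) Finset.univ
      (fun k => (MvPolynomial.X (Sum.inl (s k)) : MvPolynomial (Fin m ⊕ Fin n) ℂ))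
      (fun _ => (1, 0)) (fun k _ => MvPolynomial.isWeightedHomogeneous_X ℂ w _)
    simpa using this
  have h2 : MvPolynomial.IsWeightedHomogeneous w
      (∏ l, MvPolynomial.X (Sum.inr (t l)) : MvPolynomial (Fin m ⊕ Fin n) ℂ) (0, j) := by
    have := MvPolynomial.IsWeightedHomogeneous.prod (w := w) Finset.univ
      (fun l => (MvPolynomial.X (Sum.inr (t l)) : MvPolynomial (Fin m ⊕ Fin n) ℂ))
      (fun _ => (0, 1)) (fun l _ => MvPolynomial.isWeightedHomogeneous_X ℂ w _)
    simpa using this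
  simpa using ((MvPolynomial.isWeightedHomogeneous_C w (a s t)).mul h1).mul h2

variable {X : SubproductSystem.{u}}

section Word

variable {d : ℕ × ℕ} {m : ℕ} (e : Fin m → X.H d)

/-- The vector `e_{s₁} ⋯ e_{sᵢ}` of the Fock space. -/
def word {i : ℕ} (s : Fin i → Fin m) : X.Fock :=
  (List.ofFn fun k => X.creation (e (s k))).prod X.vacuum

theorem creation_word {i : ℕ} (k : Fin m) (s : Fin i → Fin m) :
    X.creation (e k) (word e s) = word e (Fin.cons k s : Fin (i + 1) → Fin m) := by
  simp [word, List.ofFn_succ]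

theorem word_zero (s : Fin 0 → Fin m) : word e s = X.vacuum := by
  simp [word]

end Word

/-- A functional on `X(d)`, where `d` is one of the two directions, extends to a graded character
that vanishes in the other direction if it respects all linear relations between words. -/
theorem exists_gradedCharacter {d : ℕ × ℕ} (hd : d = (1, 0) ∨ d = (0, 1)) {m : ℕ}
    (e : Module.Basis (Fin m) ℂ (X.H d)) (z : X.H d →ₗ[ℂ] ℂ)
    (H : ∀ (i : ℕ) (a : (Fin i → Fin m) → ℂ), ∑ s, a s • word e s = 0 →
      ∑ s, a s • ∏ k, z (e (s k)) = 0) :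
    ∃ ψ : X.GradedCharacter, ψ.val d = z ∧
      ∀ d' : ℕ × ℕ, (d' = (1, 0) ∨ d' = (0, 1)) → d' ≠ d → ψ.val d' = 0 := by
  have hg : ∀ i : ℕ, ∃ g : X.Fock →ₗ[ℂ] ℂ, ∀ s : Fin i → Fin m,
      g (word e s) = ∏ k, z (e (s k)) := by
    intro i
    let M := Fintype.linearCombination ℂ (fun s : Fin i → Fin m => word (X := X) e s)
    let G := Fintype.linearCombination ℂ (fun s : Fin i → Fin m => ∏ k, z (e (s k)))
    -- A functional on coefficients factors through the words exactly when it kills every linear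
    -- relation between them, which is what `H` provides.
    have hG : G ∈ LinearMap.range M.dualMap := by
      rw [LinearMap.range_dualMap_eq_dualAnnihilator_ker, Submodule.mem_dualAnnihilator]
      intro a ha
      rw [LinearMap.mem_ker, Fintype.linearCombination_apply] at ha
      rw [Fintype.linearCombination_apply]
      exact H i a ha
    obtain ⟨g, hg⟩ := hG
    refine ⟨g, fun s => ?_⟩
    have := LinearMap.congr_fun hg (Pi.single s 1)
    rw [LinearMap.dualMap_apply] at this
    simpa only [M, G, Fintype.linearCombination_apply_single, one_smul] using this
  choose g hg using hg
  let V : ℕ → Submodule ℂ X.Fock := fun i =>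
    Submodule.span ℂ (Set.range fun s : Fin i → Fin m => word e s)
  let R : X.Fock → X.H d →ₗ[ℂ] X.Fock := fun v =>
    (ContinuousLinearMap.apply ℂ X.Fock v).toLinearMap ∘ₗ
      X.tensorAlgebra.toSubmodule.subtype ∘ₗ X.shiftₗ d
  have hR : ∀ v x, R v x = X.creation x v := fun _ _ => rfl
  -- Multiplicativity of the functionals g, on the span of the words only; elsewhere g is an
  -- arbitrary extension.
  have hV : ∀ (i : ℕ) (x : X.H d), ∀ v ∈ V i, X.creation x v ∈ V (i + 1) ∧
      g (i + 1) (X.creation x v) = z x * g i v := by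
    intro i x v hv
    induction hv using Submodule.span_induction with
    | mem v hv =>
      obtain ⟨s, rfl⟩ := hv
      constructor
      · rw [← hR, ← e.sum_repr x, map_sum]
        refine Submodule.sum_mem _ fun k _ => ?_
        rw [map_smul, hR]
        refine Submodule.smul_mem _ _ (Submodule.subset_span ⟨Fin.cons k s, ?_⟩)
        exact (creation_word _ k s).symm
      · have : g (i + 1) ∘ₗ R (word e s) = g i (word e s) • z := by
          refine e.ext fun k => ?_
          rw [LinearMap.comp_apply, hR, creation_word, hg, LinearMap.smul_apply, hg,
            Fin.prod_univ_succ]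
          simp [mul_comm]
        exact (LinearMap.congr_fun this x).trans (mul_comm _ _)
    | zero => simp
    | add v w _ _ hv hw =>
      rw [map_add, map_add, hv.2, hw.2, map_add, mul_add]
      exact ⟨Submodule.add_mem _ hv.1 hw.1, rfl⟩
    | smul c v _ hv =>
      rw [map_smul, map_smul, hv.2, map_smul, smul_eq_mul, smul_eq_mul]
      exact ⟨Submodule.smul_mem _ _ hv.1, by ring⟩
  let S : ∀ t, X.H t →ₗ[ℂ] X.Fock := fun t =>
    (lp.singleContinuousLinearMap ℂ X.H 2 t).toLinearMap
  have hS : ∀ t x, S t x = lp.single 2 t x := fun _ _ => rfl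
  have hSU : ∀ (t r : ℕ × ℕ) (h : d + t = r) (x : X.H d) (y : X.H t),
      S r (X.U d t r h (x ⊗ₜ y)) = X.creation x (S t y) := by
    intro t r h x y
    rw [hS, hS, X.creation_single x t r h y]
  -- The equation t = (t.1 + t.2) • d expresses that t lies on the axis spanned by d. A sum lies on
  -- it exactly when both summands do.
  have hdeg : ∀ d' t s : ℕ × ℕ, (d' = (1, 0) ∨ d' = (0, 1)) → d' + t = s →
      (s = (s.1 + s.2) • d ↔ d' = d ∧ t = (t.1 + t.2) • d) ∧
        s.1 + s.2 = t.1 + t.2 + 1 := by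
    rintro d' ⟨t₁, t₂⟩ s hd' rfl
    rcases hd with rfl | rfl <;> rcases hd' with rfl | rfl <;> simp <;> omega
  have hSV : ∀ s : ℕ × ℕ, s = (s.1 + s.2) • d → ∀ x, S s x ∈ V (s.1 + s.2) := by
    intro s
    induction s using index_induction with
    | zero =>
      intro _ x
      obtain ⟨c, rfl⟩ := X.exists_eq_smul_Δ x
      rw [map_smul]
      exact Submodule.smul_mem _ _ (Submodule.subset_span ⟨Fin.elim0, word_zero _ _⟩)
    | step d' t s hd' hs ih =>
      intro h x
      obtain ⟨rfl, ht⟩ := (hdeg d' t s hd' hs).1.1 h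
      rw [(hdeg d' t s hd' hs).2]
      refine X.mem_of_U_tmul_mem hs (K := (V _).comap (S s)) (fun x y => ?_) x
      rw [Submodule.mem_comap, hSU]
      exact (hV _ x _ (ih ht y)).1
  classical
  -- Extension by zero off the axis stays multiplicative, because a product off the axis has a
  -- factor off the axis.
  let val : ∀ t, X.H t →ₗ[ℂ] ℂ := fun t =>
    if t = (t.1 + t.2) • d then g (t.1 + t.2) ∘ₗ S t else 0
  have val_pos : ∀ t, t = (t.1 + t.2) • d → ∀ x, val t x = g (t.1 + t.2) (S t x) := by
    intro t ht x
    simp only [val]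
    rw [if_pos ht]
    rfl
  have val_neg : ∀ t, ¬ t = (t.1 + t.2) • d → val t = 0 := fun t ht => if_neg ht
  have g_zero : g 0 X.vacuum = 1 := by
    have := hg 0 Fin.elim0
    rwa [word_zero] at this
  have hd0 : d = (d.1 + d.2) • d ∧ d.1 + d.2 = 1 := by
    rcases hd with rfl | rfl <;> simp
  have val_d : val d = z := by
    ext x
    have h := hV 0 x X.vacuum (Submodule.subset_span ⟨Fin.elim0, word_zero _ _⟩)
    rw [val_pos d hd0.1, hd0.2, hS, ← symbol_shift]
    exact h.2.trans (by rw [g_zero, mul_one])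
  have val_ne : ∀ d' : ℕ × ℕ, (d' = (1, 0) ∨ d' = (0, 1)) → d' ≠ d → val d' = 0 := by
    intro d' hd' hne
    refine val_neg _ fun h => hne ?_
    exact ((hdeg d' 0 d' hd' (add_zero _)).1.1 h).1
  refine ⟨GradedCharacter.ofLeftMul val ?_ ?_, val_d, val_ne⟩
  · rw [val_pos 0 (by simp)]
    exact g_zero
  · intro d' hd' t r h x y
    by_cases hr : r = (r.1 + r.2) • d
    · obtain ⟨rfl, ht⟩ := (hdeg d' t r hd' h).1.1 hr
      rw [val_pos r hr, val_pos t ht, (hdeg d' t r hd' h).2, hSU, val_d]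
      exact (hV _ x _ (hSV t ht y)).2
    · rw [val_neg r hr]
      by_cases hne : d' = d
      · rw [val_neg t fun ht => hr ((hdeg d' t r hd' h).1.2 ⟨hne, ht⟩)]
        simp
      · rw [val_ne d' hd' hne]
        simp

/-- A relation between words in the e_k gives a polynomial in J of degree (i, 0). Goodness makes it
the zero polynomial, so it vanishes at the point with coordinates z(e_k), and every z extends. -/
theorem Good.exists_gradedCharacter_fst (hX : X.Good) (z : X.H (1, 0) →ₗ[ℂ] ℂ) :
    ∃ ψ : X.GradedCharacter, ψ.val (1, 0) = z ∧ ψ.val (0, 1) = 0 := by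
  obtain ⟨m, n, e, f, u, -, hJ⟩ := hX
  obtain ⟨ψ, h1, h2⟩ := exists_gradedCharacter (Or.inl rfl) e.toBasis z (by
    intro i a ha
    let a' : (Fin i → Fin m) → (Fin 0 → Fin n) → ℂ := fun s _ => a s
    have hv : X.tensorValue e f a' = 0 := by
      rw [← ha]
      simp [tensorValue, a', word]
    have hp : tensorPoly a' = 0 := by
      by_contra hp
      exact lt_irrefl 0 (hJ _ (Ideal.subset_span (Or.inr ⟨i, 0, a', hv, rfl⟩)) hp i 0
        (isBihomogeneous_tensorPoly a')).2
    have := congrArg (MvPolynomial.eval (Sum.elim (fun k => z (e k)) fun _ => 0)) hp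
    simpa [tensorPoly, a'] using this)
  exact ⟨ψ, h1, h2 _ (Or.inr rfl) (by simp)⟩

theorem Good.exists_gradedCharacter_snd (hX : X.Good) (z : X.H (0, 1) →ₗ[ℂ] ℂ) :
    ∃ ψ : X.GradedCharacter, ψ.val (1, 0) = 0 ∧ ψ.val (0, 1) = z := by
  obtain ⟨m, n, e, f, u, -, hJ⟩ := hX
  obtain ⟨ψ, h1, h2⟩ := exists_gradedCharacter (Or.inr rfl) f.toBasis z (by
    intro j a ha
    let a' : (Fin 0 → Fin m) → (Fin j → Fin n) → ℂ := fun _ t => a t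
    have hv : X.tensorValue e f a' = 0 := by
      rw [← ha]
      simp [tensorValue, a', word]
    have hp : tensorPoly a' = 0 := by
      by_contra hp
      exact lt_irrefl 0 (hJ _ (Ideal.subset_span (Or.inr ⟨0, j, a', hv, rfl⟩)) hp 0 j
        (isBihomogeneous_tensorPoly a')).1
    have := congrArg (MvPolynomial.eval (Sum.elim (fun _ => 0) fun l => z (f l))) hp
    simpa [tensorPoly, a'] using this)
  exact ⟨ψ, h2 _ (Or.inl rfl) (by simp), h1⟩

/-! ### The transposed linear part acting on the cone of characters. -/

section DegreeOne

variable {X : SubproductSystem.{u}} {Y : SubproductSystem.{v}}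

/-- The component `Y(s) → X(t)` of a homomorphism of tensor algebras. -/
def component (θ : Y.tensorAlgebra →ₐ[ℂ] X.tensorAlgebra) (s t : ℕ × ℕ) :
    Y.H s →ₗ[ℂ] X.H t :=
  (X.coord t).toLinearMap ∘ₗ X.symbol.toLinearMap ∘ₗ θ.toLinearMap ∘ₗ Y.shiftₗ s

theorem component_apply (θ : Y.tensorAlgebra →ₐ[ℂ] X.tensorAlgebra) (s t : ℕ × ℕ) (η : Y.H s) :
    component θ s t η = X.symbol (θ (Y.shift η)) t := rfl

variable (X) in
/-- The dual of `X(1,0) ⊕ X(0,1)`, with the maximum norm. -/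
abbrev DegreeOneDual : Type u :=
  StrongDual ℂ (X.H (1, 0)) × StrongDual ℂ (X.H (0, 1))

/-- The transpose of the component of degree one of a homomorphism of tensor algebras. -/
def dualComponent (θ : Y.tensorAlgebra →ₐ[ℂ] X.tensorAlgebra) :
    X.DegreeOneDual →ₗ[ℂ] Y.DegreeOneDual where
  toFun v :=
    (v.1 ∘L LinearMap.toContinuousLinearMap (component θ (1, 0) (1, 0)) +
        v.2 ∘L LinearMap.toContinuousLinearMap (component θ (1, 0) (0, 1)),
      v.1 ∘L LinearMap.toContinuousLinearMap (component θ (0, 1) (1, 0)) +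
        v.2 ∘L LinearMap.toContinuousLinearMap (component θ (0, 1) (0, 1)))
  map_add' v w := by
    ext <;> simp <;> ring
  map_smul' c v := by
    ext <;> simp

theorem dualComponent_fst_apply (θ : Y.tensorAlgebra →ₐ[ℂ] X.tensorAlgebra)
    (v : X.DegreeOneDual) (η : Y.H (1, 0)) :
    (dualComponent θ v).1 η =
      v.1 (component θ (1, 0) (1, 0) η) + v.2 (component θ (1, 0) (0, 1) η) := rfl

theorem dualComponent_snd_apply (θ : Y.tensorAlgebra →ₐ[ℂ] X.tensorAlgebra)
    (v : X.DegreeOneDual) (η : Y.H (0, 1)) :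
    (dualComponent θ v).2 η =
      v.1 (component θ (0, 1) (1, 0) η) + v.2 (component θ (0, 1) (0, 1) η) := rfl

variable (X) in
/-- The degree one parts of the graded characters of `X`. -/
def characterCone : Set X.DegreeOneDual :=
  {v | ∃ ψ : X.GradedCharacter, (∀ x, ψ.val (1, 0) x = v.1 x) ∧ ∀ x, ψ.val (0, 1) x = v.2 x}

theorem smul_mem_characterCone {v : X.DegreeOneDual} (hv : v ∈ X.characterCone) (a b : ℂ) :
    (a • v.1, b • v.2) ∈ X.characterCone := by
  obtain ⟨ψ, h₁, h₂⟩ := hv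
  refine ⟨ψ.scale a b, fun x => ?_, fun x => ?_⟩
  · simp [GradedCharacter.scale, h₁]
  · simp [GradedCharacter.scale, h₂]

theorem GradedCharacter.coef_one_eq (ψ : X.GradedCharacter) (T : X.tensorAlgebra) :
    ψ.coef 1 T = ψ.val (1, 0) (X.symbol T (1, 0)) + ψ.val (0, 1) (X.symbol T (0, 1)) := by
  rw [coef_apply, Finset.Nat.antidiagonal_succ]
  simp [add_comm]

theorem dualComponent_mem_characterCone (θ : Y.tensorAlgebra →ₐ[ℂ] X.tensorAlgebra)
    (hθ : X.vacuumCharacter.comp θ = Y.vacuumCharacter) {v : X.DegreeOneDual}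
    (hv : v ∈ X.characterCone) : dualComponent θ v ∈ Y.characterCone := by
  obtain ⟨ψ, h₁, h₂⟩ := hv
  refine ⟨ψ.comap θ hθ, fun x => ?_, fun x => ?_⟩
  · rw [GradedCharacter.comap_val, dualComponent_fst_apply, ← h₁, ← h₂]
    exact ψ.coef_one_eq _
  · rw [GradedCharacter.comap_val, dualComponent_snd_apply, ← h₁, ← h₂]
    exact ψ.coef_one_eq _

/-- The Schwarz lemma with M = ‖v‖, applied to the images of generators of degree one. The maximum
norm fits because a single M must bound both parts of v. -/
theorem norm_dualComponent_le (θ : Y.tensorAlgebra →ₐ[ℂ] X.tensorAlgebra)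
    (hθ : X.vacuumCharacter.comp θ = Y.vacuumCharacter) (hn : ∀ T, ‖θ T‖ ≤ ‖T‖)
    {v : X.DegreeOneDual} (hv : v ∈ X.characterCone) : ‖dualComponent θ v‖ ≤ ‖v‖ := by
  obtain ⟨ψ, h₁, h₂⟩ := hv
  have key : ∀ {s : ℕ × ℕ} (_ : s.1 + s.2 = 1) (η : Y.H s),
      ‖ψ.coef 1 (θ (Y.shift η))‖ ≤ ‖v‖ * ‖η‖ := by
    intro s hs η
    refine (ψ.norm_coef_one_le (norm_nonneg v) (fun x => ?_) (fun x => ?_)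
      (hs ▸ hasOrder_map_shift θ hθ η)).trans ?_
    · rw [h₁]
      exact v.1.le_of_opNorm_le (norm_fst_le v) x
    · rw [h₂]
      exact v.2.le_of_opNorm_le (norm_snd_le v) x
    · gcongr
      exact (hn _).trans (Y.norm_shift η).le
  refine max_le ?_ ?_
  · refine ContinuousLinearMap.opNorm_le_bound _ (norm_nonneg _) fun η => ?_
    rw [dualComponent_fst_apply, ← h₁, ← h₂]
    exact (congrArg norm (ψ.coef_one_eq _)).symm.trans_le (key (s := (1, 0)) rfl η)
  · refine ContinuousLinearMap.opNorm_le_bound _ (norm_nonneg _) fun η => ?_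
    rw [dualComponent_snd_apply, ← h₁, ← h₂]
    exact (congrArg norm (ψ.coef_one_eq _)).symm.trans_le (key (s := (0, 1)) rfl η)

/-- Subtracting the linear part of T leaves an element of order two, and θ keeps that order. -/
theorem symbol_map_of_hasOrder_one (θ : Y.tensorAlgebra →ₐ[ℂ] X.tensorAlgebra)
    (hc : Continuous θ) (hθ : X.vacuumCharacter.comp θ = Y.vacuumCharacter)
    {T : Y.tensorAlgebra} (hT : Y.HasOrder 1 (Y.symbol T)) {t : ℕ × ℕ} (ht : t.1 + t.2 < 2) :
    X.symbol (θ T) t = component θ (1, 0) t (Y.symbol T (1, 0)) +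
      component θ (0, 1) t (Y.symbol T (0, 1)) := by
  have h : Y.HasOrder 2 (Y.symbol
      (T - Y.shift (Y.symbol T (1, 0)) - Y.shift (Y.symbol T (0, 1)))) := by
    rintro ⟨a, b⟩ hab
    rw [map_sub, map_sub]
    change Y.symbol T (a, b) - Y.symbol (Y.shift _) (a, b) - Y.symbol (Y.shift _) (a, b) = 0
    have hab : a + b < 2 := hab
    obtain ⟨rfl, rfl⟩ | ⟨rfl, rfl⟩ | ⟨rfl, rfl⟩ :
        (a = 0 ∧ b = 0) ∨ (a = 1 ∧ b = 0) ∨ (a = 0 ∧ b = 1) := by omega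
    · rw [symbol_shift_ne, symbol_shift_ne, hT] <;> simp
    · rw [symbol_shift_self, symbol_shift_ne] <;> simp
    · rw [symbol_shift_self, symbol_shift_ne] <;> simp
  have h' := h.map_two θ hc hθ t ht
  rw [map_sub, map_sub, map_sub, map_sub] at h'
  have h'' : X.symbol (θ T) t - component θ (1, 0) t (Y.symbol T (1, 0)) -
      component θ (0, 1) t (Y.symbol T (0, 1)) = 0 := h'
  rw [sub_sub, sub_eq_zero] at h''
  exact h''

/-- The chain rule for linear parts, for a composition equal to the identity. -/
theorem symbol_shift_eq_component_add (θ : Y.tensorAlgebra →ₐ[ℂ] X.tensorAlgebra)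
    (θ' : X.tensorAlgebra →ₐ[ℂ] Y.tensorAlgebra) (hc' : Continuous θ')
    (hθ : X.vacuumCharacter.comp θ = Y.vacuumCharacter)
    (hθ' : Y.vacuumCharacter.comp θ' = X.vacuumCharacter) (h : ∀ T, θ' (θ T) = T)
    {s : ℕ × ℕ} (hs : s.1 + s.2 = 1) (η : Y.H s) {t : ℕ × ℕ} (ht : t.1 + t.2 < 2) :
    Y.symbol (Y.shift η) t = component θ' (1, 0) t (component θ s (1, 0) η) +
      component θ' (0, 1) t (component θ s (0, 1) η) := by
  have := symbol_map_of_hasOrder_one θ' hc' hθ'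
    (T := θ (Y.shift η)) (hs ▸ hasOrder_map_shift θ hθ η) ht
  rwa [h] at this

theorem dualComponent_dualComponent (θ : Y.tensorAlgebra →ₐ[ℂ] X.tensorAlgebra)
    (θ' : X.tensorAlgebra →ₐ[ℂ] Y.tensorAlgebra) (hc' : Continuous θ')
    (hθ : X.vacuumCharacter.comp θ = Y.vacuumCharacter)
    (hθ' : Y.vacuumCharacter.comp θ' = X.vacuumCharacter) (h : ∀ T, θ' (θ T) = T)
    (v : Y.DegreeOneDual) : dualComponent θ (dualComponent θ' v) = v := by
  refine Prod.ext (ContinuousLinearMap.ext fun η => ?_) (ContinuousLinearMap.ext fun η => ?_)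
  · have h1 := symbol_shift_eq_component_add θ θ' hc' hθ hθ' h (s := (1, 0)) rfl η
      (t := (1, 0)) (by simp)
    have h2 := symbol_shift_eq_component_add θ θ' hc' hθ hθ' h (s := (1, 0)) rfl η
      (t := (0, 1)) (by simp)
    rw [symbol_shift_self] at h1
    rw [symbol_shift_ne _ _ (by simp)] at h2
    have h1 := congrArg v.1 h1
    have h2 := congrArg v.2 h2
    rw [map_add] at h1
    rw [map_add, map_zero] at h2
    rw [dualComponent_fst_apply, dualComponent_fst_apply, dualComponent_snd_apply]
    linear_combination -h1 - h2
  · have h1 := symbol_shift_eq_component_add θ θ' hc' hθ hθ' h (s := (0, 1)) rfl η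
      (t := (0, 1)) (by simp)
    have h2 := symbol_shift_eq_component_add θ θ' hc' hθ hθ' h (s := (0, 1)) rfl η
      (t := (1, 0)) (by simp)
    rw [symbol_shift_self] at h1
    rw [symbol_shift_ne _ _ (by simp)] at h2
    have h1 := congrArg v.2 h1
    have h2 := congrArg v.1 h2
    rw [map_add] at h1
    rw [map_add, map_zero] at h2
    rw [dualComponent_snd_apply, dualComponent_fst_apply, dualComponent_snd_apply]
    linear_combination -h1 - h2

end DegreeOne

/-! ### An isometric isomorphism respects the two directions. -/

section Isometric

variable {X : SubproductSystem.{u}} {Y : SubproductSystem.{v}}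

/-- An isometric isomorphism of tensor algebras that preserves the vacuum characters. -/
structure VacuumIso (Y : SubproductSystem.{v}) (X : SubproductSystem.{u}) where
  hom : Y.tensorAlgebra →ₐ[ℂ] X.tensorAlgebra
  inv : X.tensorAlgebra →ₐ[ℂ] Y.tensorAlgebra
  norm_hom : ∀ T, ‖hom T‖ = ‖T‖
  norm_inv : ∀ T, ‖inv T‖ = ‖T‖
  comp_hom : X.vacuumCharacter.comp hom = Y.vacuumCharacter
  comp_inv : Y.vacuumCharacter.comp inv = X.vacuumCharacter
  inv_hom : ∀ T, inv (hom T) = T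
  hom_inv : ∀ T, hom (inv T) = T

namespace VacuumIso

/-- The inverse isomorphism. -/
def symm (Φ : VacuumIso Y X) : VacuumIso X Y :=
  ⟨Φ.inv, Φ.hom, Φ.norm_inv, Φ.norm_hom, Φ.comp_inv, Φ.comp_hom, Φ.hom_inv, Φ.inv_hom⟩

theorem continuous_hom (Φ : VacuumIso Y X) : Continuous Φ.hom :=
  (AddMonoidHomClass.isometry_of_norm Φ.hom Φ.norm_hom).continuous

theorem continuous_inv (Φ : VacuumIso Y X) : Continuous Φ.inv := Φ.symm.continuous_hom

end VacuumIso

variable (Φ : VacuumIso Y X)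

theorem norm_dualComponent_eq {v : X.DegreeOneDual} (hv : v ∈ X.characterCone) :
    ‖dualComponent Φ.hom v‖ = ‖v‖ := by
  refine le_antisymm (norm_dualComponent_le Φ.hom Φ.comp_hom (fun T => (Φ.norm_hom T).le) hv) ?_
  have := norm_dualComponent_le Φ.inv Φ.comp_inv (fun T => (Φ.norm_inv T).le)
    (dualComponent_mem_characterCone Φ.hom Φ.comp_hom hv)
  rwa [dualComponent_dualComponent Φ.inv Φ.hom Φ.continuous_hom Φ.comp_inv Φ.comp_hom Φ.hom_inv] at this

theorem dualComponent_fst_or_snd {z : StrongDual ℂ (X.H (1, 0))}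
    (hz : (z, 0) ∈ X.characterCone) :
    (dualComponent Φ.hom (z, 0)).1 = 0 ∨ (dualComponent Φ.hom (z, 0)).2 = 0 := by
  have : CompleteSpace (X.H (1, 0)) := FiniteDimensional.complete ℂ _
  exact fst_eq_zero_or_snd_eq_zero_of_norm_preserving
    (fun x y => eq_zero_of_norm_add_le_of_norm_sub_le_dual) (dualComponent Φ.inv)
    (fun v hv => smul_mem_characterCone hv)
    (fun v hv => norm_dualComponent_eq Φ.symm hv)
    (dualComponent_mem_characterCone Φ.hom Φ.comp_hom hz)
    (dualComponent_dualComponent Φ.inv Φ.hom Φ.continuous_hom Φ.comp_inv Φ.comp_hom Φ.hom_inv (z, 0))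

theorem dualComponent_fst_or_snd' {z : StrongDual ℂ (X.H (0, 1))}
    (hz : (0, z) ∈ X.characterCone) :
    (dualComponent Φ.hom (0, z)).1 = 0 ∨ (dualComponent Φ.hom (0, z)).2 = 0 := by
  have : CompleteSpace (X.H (0, 1)) := FiniteDimensional.complete ℂ _
  refine fst_eq_zero_or_snd_eq_zero_of_norm_preserving (E := StrongDual ℂ (X.H (0, 1)))
    (F := StrongDual ℂ (X.H (1, 0))) (z := z)
    (fun x y => eq_zero_of_norm_add_le_of_norm_sub_le_dual)
    -- Exchanging the two factors of the target, which is isometric for the maximum norm, brings (0,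
    -- z) to the form (z, 0).
    (LinearMap.snd ℂ _ _ |>.prod (LinearMap.fst ℂ _ _) |>.comp (dualComponent Φ.inv))
    (fun v hv => smul_mem_characterCone hv) (fun v hv => ?_)
    (dualComponent_mem_characterCone Φ.hom Φ.comp_hom hz) ?_
  · rw [← norm_dualComponent_eq Φ.symm hv]
    exact max_comm _ _
  · rw [LinearMap.comp_apply,
      dualComponent_dualComponent Φ.inv Φ.hom Φ.continuous_hom Φ.comp_inv Φ.comp_hom Φ.hom_inv (0, z)]
    rfl

theorem eq_zero_of_forall_dual {G : Type*} [NormedAddCommGroup G] [NormedSpace ℂ G] {x : G}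
    (h : ∀ z : StrongDual ℂ G, z x = 0) : x = 0 :=
  (SeparatingDual.eq_zero_iff_forall_dual_eq_zero (R := ℂ) x).2 h

/-- The functionals on `X(1,0)` pull back to functionals on one of `Y(0,1)`, `Y(1,0)`. -/
theorem Good.component_fst_eq_zero (hX : X.Good) :
    (∀ η, component Φ.hom (1, 0) (1, 0) η = 0) ∨ (∀ η, component Φ.hom (0, 1) (1, 0) η = 0) := by
  have hz : ∀ z : StrongDual ℂ (X.H (1, 0)), (z, 0) ∈ X.characterCone := by
    intro z
    obtain ⟨ψ, h₁, h₂⟩ := hX.exists_gradedCharacter_fst z.toLinearMap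
    exact ⟨ψ, fun x => by rw [h₁]; rfl, fun x => by rw [h₂]; rfl⟩
  let L := (dualComponent Φ.hom).comp (LinearMap.inl ℂ _ _)
  have key := forall_eq_zero_or_forall_eq_zero (P := (LinearMap.fst ℂ _ _).comp L)
    (Q := (LinearMap.snd ℂ _ _).comp L)
    (fun z => dualComponent_fst_or_snd Φ (hz z))
  refine key.imp (fun hk η => eq_zero_of_forall_dual fun z => ?_)
    (fun hk η => eq_zero_of_forall_dual fun z => ?_)
  · have := DFunLike.congr_fun (hk z) η
    change (dualComponent Φ.hom (z, 0)).1 η = 0 at this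
    rw [dualComponent_fst_apply] at this
    simpa using this
  · have := DFunLike.congr_fun (hk z) η
    change (dualComponent Φ.hom (z, 0)).2 η = 0 at this
    rw [dualComponent_snd_apply] at this
    simpa using this

/-- The functionals on `X(0,1)` pull back to functionals on one of `Y(0,1)`, `Y(1,0)`. -/
theorem Good.component_snd_eq_zero (hX : X.Good) :
    (∀ η, component Φ.hom (1, 0) (0, 1) η = 0) ∨ (∀ η, component Φ.hom (0, 1) (0, 1) η = 0) := by
  have hz : ∀ z : StrongDual ℂ (X.H (0, 1)), (0, z) ∈ X.characterCone := by
    intro z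
    obtain ⟨ψ, h₁, h₂⟩ := hX.exists_gradedCharacter_snd z.toLinearMap
    exact ⟨ψ, fun x => by rw [h₁]; rfl, fun x => by rw [h₂]; rfl⟩
  let L := (dualComponent Φ.hom).comp (LinearMap.inr ℂ _ _)
  have key := forall_eq_zero_or_forall_eq_zero (P := (LinearMap.fst ℂ _ _).comp L)
    (Q := (LinearMap.snd ℂ _ _).comp L)
    (fun z => dualComponent_fst_or_snd' Φ (hz z))
  refine key.imp (fun hk η => eq_zero_of_forall_dual fun z => ?_)
    (fun hk η => eq_zero_of_forall_dual fun z => ?_)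
  · have := DFunLike.congr_fun (hk z) η
    change (dualComponent Φ.hom (0, z)).1 η = 0 at this
    rw [dualComponent_fst_apply] at this
    simpa using this
  · have := DFunLike.congr_fun (hk z) η
    change (dualComponent Φ.hom (0, z)).2 η = 0 at this
    rw [dualComponent_snd_apply] at this
    simpa using this

/-- The linear part of an isomorphism is injective, so a fibre of degree one on which it vanishes is
zero. -/
theorem finrank_eq_zero_of_component_eq_zero {s : ℕ × ℕ} (hs : s.1 + s.2 = 1)
    (h₁ : ∀ η, component Φ.hom s (1, 0) η = 0) (h₂ : ∀ η, component Φ.hom s (0, 1) η = 0) :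
    Module.finrank ℂ (Y.H s) = 0 := by
  rw [Module.finrank_zero_iff]
  refine ⟨fun x y => ?_⟩
  have key : ∀ η : Y.H s, η = 0 := fun η => by
    have := symbol_shift_eq_component_add Φ.hom Φ.inv Φ.continuous_inv Φ.comp_hom Φ.comp_inv Φ.inv_hom hs η
      (t := s) (by omega)
    rwa [symbol_shift_self, h₁, h₂, map_zero, map_zero, add_zero] at this
  rw [key x, key y]

/-- An automorphism of the indices is the identity or the coordinate switch. -/
def IsSwitch (π : ℕ × ℕ ≃+ ℕ × ℕ) : Prop :=
  π = AddEquiv.refl (ℕ × ℕ) ∨ π = AddEquiv.prodComm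

theorem Good.exists_switch (hX : X.Good)
    (hY : 0 < Module.finrank ℂ (X.H (1, 0)) → 0 < Module.finrank ℂ (X.H (0, 1)) →
      0 < Module.finrank ℂ (Y.H (1, 0)) ∧ 0 < Module.finrank ℂ (Y.H (0, 1))) :
    ∃ π : ℕ × ℕ ≃+ ℕ × ℕ, IsSwitch π ∧
      ∀ s t : ℕ × ℕ, s.1 + s.2 = 1 → t.1 + t.2 = 1 → s ≠ π t → ∀ η, component Φ.hom s t η = 0 := by
  have straight : (∀ η, component Φ.hom (1, 0) (0, 1) η = 0) →
      (∀ η, component Φ.hom (0, 1) (1, 0) η = 0) → ∃ π : ℕ × ℕ ≃+ ℕ × ℕ, IsSwitch π ∧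
      ∀ s t : ℕ × ℕ, s.1 + s.2 = 1 → t.1 + t.2 = 1 → s ≠ π t →
        ∀ η, component Φ.hom s t η = 0 := by
    intro h₁ h₂
    refine ⟨_, Or.inl rfl, ?_⟩
    rintro ⟨a, b⟩ ⟨c, d⟩ hab hcd hne
    simp only [AddEquiv.refl_apply, ne_eq, Prod.mk.injEq] at hab hcd hne
    obtain ⟨rfl, rfl, rfl, rfl⟩ | ⟨rfl, rfl, rfl, rfl⟩ :
      (a = 1 ∧ b = 0 ∧ c = 0 ∧ d = 1) ∨ (a = 0 ∧ b = 1 ∧ c = 1 ∧ d = 0) := by omega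
    exacts [h₁, h₂]
  have switch : (∀ η, component Φ.hom (1, 0) (1, 0) η = 0) →
      (∀ η, component Φ.hom (0, 1) (0, 1) η = 0) → ∃ π : ℕ × ℕ ≃+ ℕ × ℕ, IsSwitch π ∧
      ∀ s t : ℕ × ℕ, s.1 + s.2 = 1 → t.1 + t.2 = 1 → s ≠ π t →
        ∀ η, component Φ.hom s t η = 0 := by
    intro h₁ h₂
    refine ⟨_, Or.inr rfl, ?_⟩
    rintro ⟨a, b⟩ ⟨c, d⟩ hab hcd hne
    have hne : ¬ (a = d ∧ b = c) := fun hh => hne (Prod.ext hh.1 hh.2)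
    simp only at hab hcd
    obtain ⟨rfl, rfl, rfl, rfl⟩ | ⟨rfl, rfl, rfl, rfl⟩ :
      (a = 1 ∧ b = 0 ∧ c = 1 ∧ d = 0) ∨ (a = 0 ∧ b = 1 ∧ c = 0 ∧ d = 1) := by omega
    exacts [h₁, h₂]
  have trivial_of : ∀ {s t : ℕ × ℕ}, Module.finrank ℂ (X.H t) = 0 →
      ∀ η, component Φ.hom s t η = 0 := by
    intro s t h0 η
    have := Module.finrank_zero_iff.1 h0
    exact Subsingleton.elim _ _
  have degenerate : Module.finrank ℂ (Y.H (1, 0)) = 0 ∨ Module.finrank ℂ (Y.H (0, 1)) = 0 →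
      Module.finrank ℂ (X.H (1, 0)) = 0 ∨ Module.finrank ℂ (X.H (0, 1)) = 0 := by
    intro h0
    by_contra! hne
    have := hY (Nat.pos_of_ne_zero hne.1) (Nat.pos_of_ne_zero hne.2)
    omega
  -- In the two mixed cases both X(1,0) and X(0,1) receive from the same fibre of Y, so the other
  -- degree one fibre of Y is zero. Then `hY` makes one degree one fibre of X zero as well, and the
  -- missing condition holds trivially.
  rcases hX.component_fst_eq_zero Φ with hE | hE <;>
    rcases hX.component_snd_eq_zero Φ with hF | hF
  · rcases degenerate (Or.inl (finrank_eq_zero_of_component_eq_zero Φ (s := (1, 0)) rfl hE hF)) with h0 | h0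
    · exact straight hF (trivial_of h0)
    · exact switch hE (trivial_of h0)
  · exact switch hE hF
  · exact straight hF hE
  · rcases degenerate (Or.inr (finrank_eq_zero_of_component_eq_zero Φ (s := (0, 1)) rfl hE hF)) with h0 | h0
    · exact switch (trivial_of h0) hF
    · exact straight (trivial_of h0) hE

end Isometric

/-! ### From degree one to unitaries of the fibres and Fock spaces. -/

section Conclusion

variable {X : SubproductSystem.{u}} {Y : SubproductSystem.{v}}

theorem eq_single_of_norm_le {t : ℕ × ℕ} {f : X.Fock} (h : ‖f‖ ≤ ‖f t‖) :
    f = lp.single 2 t (f t) := by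
  have horth : inner ℂ (lp.single 2 t (f t) : X.Fock) (f - lp.single 2 t (f t)) = 0 := by
    rw [lp.inner_single_left]
    change inner ℂ (f t) (f t - (lp.single 2 t (f t) : X.Fock) t) = 0
    rw [lp.single_apply_self, sub_self, inner_zero_right]
  have hn := norm_add_sq_eq_norm_sq_add_norm_sq_of_inner_eq_zero _ _ horth
  rw [add_sub_cancel, lp.norm_single (by norm_num)] at hn
  have : ‖f - lp.single 2 t (f t)‖ = 0 := by
    nlinarith [norm_nonneg (f - lp.single 2 t (f t)), norm_nonneg f]
  exact sub_eq_zero.1 (norm_eq_zero.1 this)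

theorem eq_or_eq_of_add_eq_one {t : ℕ × ℕ} (ht : t.1 + t.2 = 1) : t = (1, 0) ∨ t = (0, 1) := by
  obtain ⟨a, b⟩ := t
  simp only [Prod.mk.injEq] at ht ⊢
  omega

theorem IsSwitch.apply_apply {π : ℕ × ℕ ≃+ ℕ × ℕ} (hπ : IsSwitch π) (t : ℕ × ℕ) :
    π (π t) = t := by
  rcases hπ with rfl | rfl <;> rfl

theorem IsSwitch.add_eq {π : ℕ × ℕ ≃+ ℕ × ℕ} (hπ : IsSwitch π) (t : ℕ × ℕ) :
    (π t).1 + (π t).2 = t.1 + t.2 := by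
  rcases hπ with rfl | rfl
  · rfl
  · exact add_comm _ _

namespace VacuumIso

variable (Φ : VacuumIso Y X) {π : ℕ × ℕ ≃+ ℕ × ℕ}

theorem inv_component_hom (hπ : IsSwitch π)
    (hΦ : ∀ s t : ℕ × ℕ, s.1 + s.2 = 1 → t.1 + t.2 = 1 → s ≠ π t →
      ∀ η, component Φ.hom s t η = 0)
    {t : ℕ × ℕ} (ht : t.1 + t.2 = 1) (η : Y.H (π t)) :
    component Φ.inv t (π t) (component Φ.hom (π t) t η) = η := by
  have hs : (π t).1 + (π t).2 = 1 := (hπ.add_eq t).trans ht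
  have key := symbol_shift_eq_component_add Φ.hom Φ.inv Φ.continuous_inv Φ.comp_hom Φ.comp_inv
    Φ.inv_hom hs η (t := π t) (by omega)
  rw [symbol_shift_self] at key
  rcases eq_or_eq_of_add_eq_one ht with rfl | rfl
  · rw [hΦ _ (0, 1) hs rfl (fun e => by simpa using π.injective e), map_zero, add_zero] at key
    exact key.symm
  · rw [hΦ _ (1, 0) hs rfl (fun e => by simpa using π.injective e), map_zero, zero_add] at key
    exact key.symm

/-- Vanishing of the off-diagonal components is only known for `Φ.hom`, but in the chain rule it
already removes the unwanted summand. -/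
theorem component_hom_inv (hπ : IsSwitch π)
    (hΦ : ∀ s t : ℕ × ℕ, s.1 + s.2 = 1 → t.1 + t.2 = 1 → s ≠ π t →
      ∀ η, component Φ.hom s t η = 0)
    {t : ℕ × ℕ} (ht : t.1 + t.2 = 1) (ξ : X.H t) :
    component Φ.hom (π t) t (component Φ.inv t (π t) ξ) = ξ := by
  have key := symbol_shift_eq_component_add Φ.inv Φ.hom Φ.continuous_hom Φ.comp_inv Φ.comp_hom
    Φ.hom_inv ht ξ (t := t) (by omega)
  rw [symbol_shift_self] at key
  have hs : (π t).1 + (π t).2 = 1 := (hπ.add_eq t).trans ht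
  have hne : ∀ s : ℕ × ℕ, s.1 + s.2 = 1 → s ≠ π t → ∀ η, component Φ.hom s t η = 0 :=
    fun s hs => hΦ s t hs ht
  generalize π t = r at *
  rcases eq_or_eq_of_add_eq_one hs with rfl | rfl
  · rw [hne (0, 1) rfl (by simp), add_zero] at key
    exact key.symm
  · rw [hne (1, 0) rfl (by simp), zero_add] at key
    exact key.symm

/-- The whole symbol of the image has norm at most ‖η‖, while its coordinate at t already has at
least this norm because `Φ.inv` recovers η from it contractively. All other coordinates vanish, and
the symbol determines the operator. -/
theorem hom_shift_eq (hπ : IsSwitch π)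
    (hΦ : ∀ s t : ℕ × ℕ, s.1 + s.2 = 1 → t.1 + t.2 = 1 → s ≠ π t →
      ∀ η, component Φ.hom s t η = 0)
    {t : ℕ × ℕ} (ht : t.1 + t.2 = 1) (η : Y.H (π t)) :
    Φ.hom (Y.shift η) = X.shift (component Φ.hom (π t) t η) := by
  apply X.symbol_injective
  rw [symbol_shift]
  refine eq_single_of_norm_le ?_
  calc ‖X.symbol (Φ.hom (Y.shift η))‖ ≤ ‖Φ.hom (Y.shift η)‖ := X.norm_symbol_le _
    _ = ‖η‖ := by rw [Φ.norm_hom, norm_shift]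
    _ = ‖component Φ.inv t (π t) (component Φ.hom (π t) t η)‖ := by
        rw [Φ.inv_component_hom hπ hΦ ht]
    _ ≤ ‖Y.symbol (Φ.inv (X.shift (component Φ.hom (π t) t η)))‖ :=
        lp.norm_apply_le_norm two_ne_zero _ _
    _ ≤ ‖Φ.inv (X.shift (component Φ.hom (π t) t η))‖ := Y.norm_symbol_le _
    _ = ‖component Φ.hom (π t) t η‖ := by rw [Φ.norm_inv, norm_shift]

theorem exists_inv_shift_eq (hπ : IsSwitch π)
    (hΦ : ∀ s t : ℕ × ℕ, s.1 + s.2 = 1 → t.1 + t.2 = 1 → s ≠ π t →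
      ∀ η, component Φ.hom s t η = 0) (s : ℕ × ℕ) (ξ : X.H s) :
    ∃ η : Y.H (π s), Φ.inv (X.shift ξ) = Y.shift η := by
  refine exists_map_shift_eq Φ.inv π.toAddMonoidHom (fun d hd x => ?_) s ξ
  have hd1 : d.1 + d.2 = 1 := by rcases hd with rfl | rfl <;> rfl
  refine ⟨component Φ.inv d (π d) x, ?_⟩
  have := Φ.hom_shift_eq hπ hΦ hd1 (component Φ.inv d (π d) x)
  rw [Φ.component_hom_inv hπ hΦ hd1] at this
  rw [← this]
  exact Φ.inv_hom _

theorem exists_hom_shift_eq (hπ : IsSwitch π)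
    (hΦ : ∀ s t : ℕ × ℕ, s.1 + s.2 = 1 → t.1 + t.2 = 1 → s ≠ π t →
      ∀ η, component Φ.hom s t η = 0) (s : ℕ × ℕ) (η : Y.H (π s)) :
    ∃ ξ : X.H s, Φ.hom (Y.shift η) = X.shift ξ := by
  -- Needed because the general lemma lands in the fibre at π (π s), equal to s only
  -- propositionally.
  have transport : ∀ {r : ℕ × ℕ} (_ : r = s) {T : X.tensorAlgebra},
      (∃ ξ : X.H r, T = X.shift ξ) → ∃ ξ : X.H s, T = X.shift ξ := by
    rintro r rfl T hT
    exact hT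
  refine transport (hπ.apply_apply s)
    (exists_map_shift_eq Φ.hom π.toAddMonoidHom (fun d hd y => ?_) (π s) η)
  have hd1 : d.1 + d.2 = 1 := by rcases hd with rfl | rfl <;> rfl
  have key : ∀ {r : ℕ × ℕ} (_ : r.1 + r.2 = 1) (_ : d = π r), ∃ x : X.H r,
      Φ.hom (Y.shift y) = X.shift x := by
    rintro r hr rfl
    exact ⟨_, Φ.hom_shift_eq hπ hΦ hr y⟩
  exact key ((hπ.add_eq d).trans hd1) (hπ.apply_apply d).symm

/-- The unitaries between the fibres induced by an isomorphism that permutes the generators. -/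
theorem exists_fibre_unitary (hπ : IsSwitch π)
    (hΦ : ∀ s t : ℕ × ℕ, s.1 + s.2 = 1 → t.1 + t.2 = 1 → s ≠ π t →
      ∀ η, component Φ.hom s t η = 0) :
    ∃ V : ∀ s : ℕ × ℕ, X.H s ≃ₗᵢ[ℂ] Y.H (π s),
      ∀ (s : ℕ × ℕ) (ξ : X.H s), Φ.inv (X.shift ξ) = Y.shift (V s ξ) := by
  have hV : ∀ (s : ℕ × ℕ) (ξ : X.H s),
      Φ.inv (X.shift ξ) = Y.shift (component Φ.inv s (π s) ξ) := by
    intro s ξ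
    obtain ⟨η, hη⟩ := Φ.exists_inv_shift_eq hπ hΦ s ξ
    rw [component_apply, hη, symbol_shift_self]
  refine ⟨fun s => LinearIsometryEquiv.ofSurjective
    ⟨component Φ.inv s (π s), fun ξ => ?_⟩ fun η => ?_, hV⟩
  · rw [← Y.norm_shift, ← hV, Φ.norm_inv, norm_shift]
  · obtain ⟨ξ, hξ⟩ := Φ.exists_hom_shift_eq hπ hΦ s η
    refine ⟨ξ, Y.shift_injective ?_⟩
    rw [← Φ.inv_hom (Y.shift η), hξ]
    exact (hV s ξ).symm

end VacuumIso

/-- A family of unitaries between the fibres assembles to a unitary of the Fock spaces. -/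
theorem exists_fock_unitary (π : ℕ × ℕ ≃+ ℕ × ℕ)
    (V : ∀ s : ℕ × ℕ, X.H s ≃ₗᵢ[ℂ] Y.H (π s)) :
    ∃ W : X.Fock ≃ₗᵢ[ℂ] Y.Fock,
      ∀ (s : ℕ × ℕ) (x : X.H s), W (lp.single 2 s x) = lp.single 2 (π s) (V s x) := by
  let J : ∀ s, X.H s →ₗᵢ[ℂ] Y.Fock := fun s =>
    ⟨(lp.singleContinuousLinearMap ℂ Y.H 2 (π s)).toLinearMap ∘ₗ (V s).toLinearEquiv.toLinearMap,
      fun x => (lp.norm_single (by norm_num) _ _).trans ((V s).norm_map x)⟩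
  have hJ : ∀ s x, J s x = lp.single 2 (π s) (V s x) := fun _ _ => rfl
  have : ∀ s, CompleteSpace (X.H s) := fun s => FiniteDimensional.complete ℂ _
  have : ∀ s, CompleteSpace (Y.H s) := fun s => FiniteDimensional.complete ℂ _
  have hsum : IsHilbertSum ℂ X.H J := by
    refine IsHilbertSum.mk ?_ ?_
    · intro s t hst x y
      rw [hJ, hJ, lp.inner_single_left, lp.single_apply_ne _ _ _ (fun e => hst (π.injective e)),
        inner_zero_right]
    · intro f _
      have hf := lp.hasSum_single (E := Y.H) (p := 2) (by norm_num) f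
      refine mem_closure_of_tendsto hf (Filter.Eventually.of_forall fun S => ?_)
      refine Submodule.sum_mem _ fun t _ => ?_
      obtain ⟨s, rfl⟩ := π.surjective t
      refine Submodule.mem_iSup_of_mem s ⟨(V s).symm (f (π s)), ?_⟩
      change J s _ = _
      rw [hJ, LinearIsometryEquiv.apply_symm_apply]
  exact ⟨hsum.linearIsometryEquiv.symm, fun s x =>
    (hsum.linearIsometryEquiv_symm_apply_single x).trans (hJ s x)⟩

theorem intertwine_of_shift (θ : X.tensorAlgebra →ₐ[ℂ] Y.tensorAlgebra) (hθ : Continuous θ)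
    {π : ℕ × ℕ ≃+ ℕ × ℕ} {V : ∀ s : ℕ × ℕ, X.H s ≃ₗᵢ[ℂ] Y.H (π s)}
    (hV : ∀ (s : ℕ × ℕ) (ξ : X.H s), θ (X.shift ξ) = Y.shift (V s ξ))
    (hU : ∀ (s t r : ℕ × ℕ) (h : s + t = r) (x : X.H s) (y : X.H t),
        V r (X.U s t r h (x ⊗ₜ y)) =
          Y.U (π s) (π t) (π r) (by rw [← map_add, h]) (V s x ⊗ₜ V t y))
    {W : X.Fock ≃ₗᵢ[ℂ] Y.Fock}
    (hW : ∀ (s : ℕ × ℕ) (x : X.H s), W (lp.single 2 s x) = lp.single 2 (π s) (V s x))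
    (S : X.tensorAlgebra) (f : X.Fock) :
    W ((S : X.Fock →L[ℂ] X.Fock) f) = (θ S : Y.Fock →L[ℂ] Y.Fock) (W f) := by
  let ι := X.tensorAlgebra.toSubmodule.subtypeL
  let κ := Y.tensorAlgebra.toSubmodule.subtypeL
  let WL : X.Fock →L[ℂ] Y.Fock := W.toContinuousLinearEquiv.toContinuousLinearMap
  let f₁ : X.tensorAlgebra →ₗ[ℂ] X.Fock →L[ℂ] Y.Fock :=
    { toFun := fun S => WL ∘L ι S
      map_add' := by intro S T; ext1 f; simp
      map_smul' := by intro c T; ext1 f; simp }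
  let f₂ : X.tensorAlgebra →ₗ[ℂ] X.Fock →L[ℂ] Y.Fock :=
    { toFun := fun S => κ (θ S) ∘L WL
      map_add' := by intro S T; ext1 f; simp
      map_smul' := by intro c T; ext1 f; simp }
  have h₁ : Continuous f₁ := continuous_const.clm_comp ι.continuous
  have h₂ : Continuous f₂ := (κ.continuous.comp hθ).clm_comp continuous_const
  refine DFunLike.congr_fun (X.ext_of_shift h₁ h₂ (fun s x => ?_) S) f
  -- After reduction to generators, vectors in one summand suffice; there the claim is the
  -- compatibility of V with the products.
  refine lp.ext_continuousLinearMap (by norm_num) fun t => ContinuousLinearMap.ext fun y => ?_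
  change W (X.creation x (lp.single 2 t y)) = (θ (X.shift x) : Y.Fock →L[ℂ] Y.Fock)
    (W (lp.single 2 t y))
  rw [X.creation_single x t _ rfl, hW, hW, hV, hU]
  exact (Y.creation_single (V s x) (π t) _ _ _).symm

end Conclusion

end SubproductSystem
end

theorem mainTheorem2 (X : SubproductSystem.{u}) (Y : SubproductSystem.{v}) (hX : X.Good)
    (hY : 0 < Module.finrank ℂ (X.H (1, 0)) → 0 < Module.finrank ℂ (X.H (0, 1)) →
      0 < Module.finrank ℂ (Y.H (1, 0)) ∧ 0 < Module.finrank ℂ (Y.H (0, 1)))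
    (φ : Y.tensorAlgebra ≃ₐ[ℂ] X.tensorAlgebra) (hφ : Isometry φ)
    (hvac : X.vacuumCharacter.comp φ.toAlgHom =
      Y.vacuumCharacter) :
    X.Isomorphic Y ∧
      ∃ V : X.Fock ≃ₗᵢ[ℂ] Y.Fock, ∀ (T : Y.tensorAlgebra) (x : X.Fock),
        (φ T : X.Fock →L[ℂ] X.Fock) x = V.symm ((T : Y.Fock →L[ℂ] Y.Fock) (V x)) := by
  have hn : ∀ T, ‖φ T‖ = ‖T‖ := hφ.norm_map_of_map_zero (map_zero φ)
  let Φ : SubproductSystem.VacuumIso Y X :=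
    { hom := φ.toAlgHom
      inv := φ.symm.toAlgHom
      norm_hom := hn
      norm_inv := fun T => by
        have := hn (φ.symm T)
        rw [φ.apply_symm_apply] at this
        exact this.symm
      comp_hom := hvac
      comp_inv := by
        rw [← hvac]
        ext T
        exact congrArg X.vacuumCharacter (φ.apply_symm_apply T)
      inv_hom := φ.symm_apply_apply
      hom_inv := φ.apply_symm_apply }
  obtain ⟨π, hπ, hΦ⟩ := hX.exists_switch Φ hY
  obtain ⟨V, hV⟩ := Φ.exists_fibre_unitary hπ hΦ
  have hU : ∀ (s t r : ℕ × ℕ) (h : s + t = r) (x : X.H s) (y : X.H t),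
      V r (X.U s t r h (x ⊗ₜ y)) =
        Y.U (π s) (π t) (π r) (by rw [← map_add, h]) (V s x ⊗ₜ V t y) := by
    intro s t r h x y
    apply Y.shift_injective
    rw [← hV, X.shift_U_tmul, Y.shift_U_tmul, map_mul, hV, hV]
  obtain ⟨W, hW⟩ := SubproductSystem.exists_fock_unitary π V
  refine ⟨⟨π, hπ, V, hU⟩, W, fun T x => ?_⟩
  have := SubproductSystem.intertwine_of_shift Φ.inv Φ.continuous_inv hV hU hW (φ T) x
  rw [← W.symm_apply_apply ((φ T : X.Fock →L[ℂ] X.Fock) x), this]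
  exact congrArg (fun S : Y.tensorAlgebra => W.symm ((S : Y.Fock →L[ℂ] Y.Fock) (W x)))
    (φ.symm_apply_apply T)
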